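/- For $d\ge 1$ let $A$ be the random symmetric $d\times d$ matrix whose diagonal entries are $0$ and whose entries above the diagonal are independent $\mathcal N(0,1/d^2)$ random variables (standard deviation $1/d$). Write $\|\cdot\|_2$ and $\|\cdot\|_F$ for the spectral and the Frobenius norm, and for real constants $C_1,C_2$ let $\mathcal E_d(C_1,C_2)$ be the event that $\|A\|_2\le C_1/\sqrt d$ and $\|A\|_F\le C_2$. For a symmetric matrix $A$ put $$\mathbf D_A=\tfrac{9}{10}\,\mathcal N(0,I+A)+\tfrac1{10}\,\mathcal N(0,I-9A),$$ a distribution on $\mathbb R^d$ whenever $I+A$ and $I-9A$ are positive semidefinite (on $\mathcal E_d(C_1,C_2)$ this is the case for all large $d$). Let $\mathcal D^N=\mathcal D^N_{d,C_1,C_2}$ be the distribution on $(\mathbb R^d)^N$ obtained by drawing $A$ from its law conditioned on $\mathcal E_d(C_1,C_2)$ and then taking $N$ i.i.d. samples from $\mathbf D_A$. Let $G=\mathcal N(0,I)$ on $\mathbb R^d$, let $G^N$ be the law of $N$ i.i.d. samples from $G$, and let $\chi^2_P(Q,R)=\int \frac{dQ\,dR}{dP}$. **Proposition.** (i) For all sufficiently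 large constants $C_1,C_2$, $\Pr[\mathcal E_d(C_1,C_2)]\to1$ as $d\to\infty$. (ii) Let $C_1,C_2$ be any constants with $\Pr[\mathcal E_d(C_1,C_2)]\to 1$ as $d\to\infty$. For every sequence $N=N(d)$ of non-negative integers with $N=o(d^2)$, $$\chi^2_{G^N}(\mathcal D^N,\mathcal D^N)=1+o(1)\qquad (d\to\infty).$$ -/

import Mathlib

open MeasureTheory ProbabilityTheory Filter Topology Asymptotics
open scoped ENNReal NNReal

noncomputable section

namespace RobustCov

/-- The chi-squared inner product `χ²_A(B, C) = ∫ dB dC / dA`, as an extended non-negative real,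
computed with densities with respect to the dominating measure `A + B + C`
(with `0 / 0 = 0` and `t / 0 = ∞` for `t > 0`). -/
def chiSq {α : Type*} [MeasurableSpace α] (A B C : Measure α) : ℝ≥0∞ :=
  ∫⁻ x, B.rnDeriv (A + B + C) x * C.rnDeriv (A + B + C) x / A.rnDeriv (A + B + C) x ∂(A + B + C)

/-- If `B` and `C` are absolutely continuous with respect to `A`, then
`χ²_A(B, C) = ∫ (dB/dA) (dC/dA) dA`. -/
theorem chiSq_eq_of_ac {α : Type*} [MeasurableSpace α] (A B C : Measure α)
    [SigmaFinite A] [SigmaFinite B] [SigmaFinite C] (hB : B ≪ A) (hC : C ≪ A) :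
    chiSq A B C = ∫⁻ x, B.rnDeriv A x * C.rnDeriv A x ∂A := by
  have hA : A ≪ A + B + C := by
    rw [add_assoc]; exact Measure.le_add_right le_rfl |>.absolutelyContinuous
  have h1 := Measure.rnDeriv_mul_rnDeriv (κ := A + B + C) hB
  have h2 := Measure.rnDeriv_mul_rnDeriv (κ := A + B + C) hC
  have h3 := Measure.rnDeriv_lt_top A (A + B + C)
  have h4 : ∫⁻ x, B.rnDeriv A x * C.rnDeriv A x ∂A =
      ∫⁻ x, A.rnDeriv (A + B + C) x * (B.rnDeriv A x * C.rnDeriv A x) ∂(A + B + C) :=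
    (lintegral_rnDeriv_mul hA (by fun_prop)).symm
  rw [h4, chiSq]
  refine lintegral_congr_ae ?_
  filter_upwards [h1, h2, h3] with x h1 h2 h3
  simp only [Pi.mul_apply] at h1 h2
  rw [← h1, ← h2]
  by_cases h0 : A.rnDeriv (A + B + C) x = 0
  · simp [h0]
  · rw [mul_mul_mul_comm, ← mul_assoc, mul_div_assoc, ENNReal.div_self h0 h3.ne, mul_one,
      mul_comm]

/-- The symmetric `d × d` matrix with zero diagonal and with entries `g` above the diagonal. -/
def symMatrix {d : ℕ} (g : {p : Fin d × Fin d // p.1 < p.2} → ℝ) : Matrix (Fin d) (Fin d) ℝ :=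
  Matrix.of fun i j =>
    if h : i < j then g ⟨(i, j), h⟩ else if h : j < i then g ⟨(j, i), h⟩ else 0

/-- The joint law of the entries above the diagonal: independent centred Gaussians with
standard deviation `1 / d`, i.e. variance `1 / d ^ 2`. -/
def entryLaw (d : ℕ) : Measure ({p : Fin d × Fin d // p.1 < p.2} → ℝ) :=
  Measure.pi fun _ => gaussianReal 0 (1 / (d : ℝ≥0) ^ 2)

/-- The spectral norm of a real square matrix: the operator norm of the map it induces on
Euclidean space. -/
def matSpectralNorm {d : ℕ} (A : Matrix (Fin d) (Fin d) ℝ) : ℝ :=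
  ‖Matrix.toEuclideanCLM (n := Fin d) (𝕜 := ℝ) A‖

/-- The Frobenius norm of a real square matrix. -/
def frobeniusNorm {d : ℕ} (A : Matrix (Fin d) (Fin d) ℝ) : ℝ :=
  √(∑ i, ∑ j, A i j ^ 2)

/-- The event that the random matrix `A` satisfies `‖A‖₂ ≤ C₁ / √d` and `‖A‖_F ≤ C₂`. -/
def normEvent (d : ℕ) (C₁ C₂ : ℝ) : Set ({p : Fin d × Fin d // p.1 < p.2} → ℝ) :=
  {g | matSpectralNorm (symMatrix g) ≤ C₁ / √(d : ℝ) ∧ frobeniusNorm (symMatrix g) ≤ C₂}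

/-- The noisy Gaussian `(9/10) N(0, I + A) + (1/10) N(0, I - 9 A)` on `ℝ^d`. -/
def noisyGaussian {d : ℕ} (A : Matrix (Fin d) (Fin d) ℝ) : Measure (EuclideanSpace ℝ (Fin d)) :=
  (9 / 10 : ℝ≥0∞) • multivariateGaussian 0 (1 + A) +
    (1 / 10 : ℝ≥0∞) • multivariateGaussian 0 (1 - (9 : ℝ) • A)

/-- The law of `N` i.i.d. samples from a distribution `P`. -/
def iidSamples {E : Type*} [MeasurableSpace E] (N : ℕ) (P : Measure E) : Measure (Fin N → E) :=
  Measure.pi fun _ => P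

/-- The standard Gaussian distribution `G = N(0, I)` on `ℝ^d`. -/
def stdG (d : ℕ) : Measure (EuclideanSpace ℝ (Fin d)) := multivariateGaussian 0 1

/-- The distribution `𝒟^N`: pick the random matrix `A` from its Gaussian law conditioned on
`‖A‖₂ ≤ C₁ / √d` and `‖A‖_F ≤ C₂`, and return `N` i.i.d. samples from the noisy Gaussian of `A`. -/
def ensembleSamples (d : ℕ) (C₁ C₂ : ℝ) (N : ℕ) :
    Measure (Fin N → EuclideanSpace ℝ (Fin d)) :=
  (ProbabilityTheory.cond (entryLaw d) (normEvent d C₁ C₂)).bind fun g =>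
    iidSamples N (noisyGaussian (symMatrix g))

end RobustCov

end

/-! Part (ii) is a second moment computation. By Tonelli the chi-squared of the mixture is the
average, over two independent conditioned matrices $A,B$, of the $N$-th power of the one-sample
quantity $\chi^2_G(\mathbf D_A,\mathbf D_B)$. The Gaussian integral $\int
\frac{dN(0,I+A)\,dN(0,I+B)}{dG}=\det(I-AB)^{-1/2}$ turns this quantity into a combination of
$\det(I-tAB)^{-1/2}$ for $t=1,-9,81$ with weights $.81,.18,.01$.

Expanding, $\det(I-tM)^{-1/2}\le\exp(t\,\mathrm{tr}M/2+t^2\,\mathrm{tr}M^2/4+O(d\|M\|^3))$ for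
$M=AB$, and $\|M\|=O(1/d)$ makes the error $O(1/d^2)$. The mixture is chosen so that its mean
covariance is $I$: the weighted sum of the $t$ vanishes, so the term linear in $\mathrm{tr}(AB)$
cancels. What remains is at most $\exp(L\,\mathrm{tr}(AB)^2+\frac{81}4\mathrm{tr}(ABAB)+L/d^2)$
(`exists_noisyChiSq_le`).

For fixed $B$ the exponent is, up to the last term, a quadratic form in the entries of $A$, which
have variance $1/d^2$. With $N=\varepsilon d^2$ the scalings cancel and leave
$\varepsilon\,x^{\mathsf T}Kx$ with $x$ standard Gaussian, where the trace and the Frobenius norm of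
$K$ are bounded through $\|B\|_F\le C_2$. Its exponential moment is $\exp(O(\varepsilon))$
(`lintegral_exp_quadraticForm_le`, `lintegral_entryLaw_exp_traceForm_le`). Dropping the conditioning
on $A$ costs a factor $1/\Pr[\mathcal E_d]\to1$. The matching lower bound 1 is Cauchy–Schwarz.

Part (i) consists of two exponential Markov bounds. For the spectral norm, a volume average over a
ball replaces the usual net on the sphere. -/

/-! ### Product measures and densities -/

theorem MeasureTheory.lintegral_fin_nat_prod_eq_prod {n : ℕ} {E : Fin n → Type*}
    {mE : ∀ i, MeasurableSpace (E i)} {μ : (i : Fin n) → Measure (E i)} [∀ i, SigmaFinite (μ i)]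
    {f : (i : Fin n) → E i → ℝ≥0∞} (hf : ∀ i, Measurable (f i)) :
    ∫⁻ x : (i : Fin n) → E i, ∏ i, f i (x i) ∂(Measure.pi μ) = ∏ i, ∫⁻ x, f i x ∂(μ i) := by
  induction n with
  | zero => simp
  | succ n n_ih =>
      calc
        _ = ∫⁻ x : E 0 × ((i : Fin n) → E (Fin.succ i)),
            f 0 x.1 * ∏ i : Fin n, f (Fin.succ i) (x.2 i)
            ∂((μ 0).prod (Measure.pi (fun i ↦ μ i.succ))) := by
          refine (((measurePreserving_piFinSuccAbove μ 0).symm).lintegral_comp_emb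
            (MeasurableEquiv.measurableEmbedding _) _).symm.trans (lintegral_congr fun x => ?_)
          rw [Fin.prod_univ_succ]
          rfl
        _ = (∫⁻ x, f 0 x ∂μ 0)
            * ∏ i : Fin n, ∫⁻ (x : E (Fin.succ i)), f (Fin.succ i) x ∂(μ i.succ) := by
          rw [← n_ih fun i => hf _, ← lintegral_prod_mul (hf 0).aemeasurable]
          have := fun i : Fin n => hf i.succ
          exact Measurable.aemeasurable (by fun_prop)
        _ = ∏ i, ∫⁻ x, f i x ∂(μ i) := by rw [Fin.prod_univ_succ]

theorem MeasureTheory.lintegral_fintype_prod_eq_prod {ι : Type*} [Fintype ι] {E : ι → Type*}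
    {mE : ∀ i, MeasurableSpace (E i)} {μ : (i : ι) → Measure (E i)} [∀ i, SigmaFinite (μ i)]
    {f : (i : ι) → E i → ℝ≥0∞} (hf : ∀ i, Measurable (f i)) :
    ∫⁻ x : (i : ι) → E i, ∏ i, f i (x i) ∂(Measure.pi μ) = ∏ i, ∫⁻ x, f i x ∂(μ i) := by
  let e := (Fintype.equivFin ι).symm
  rw [← (measurePreserving_piCongrLeft _ e).lintegral_comp_emb
    (MeasurableEquiv.measurableEmbedding _)]
  simp_rw [← e.prod_comp, MeasurableEquiv.coe_piCongrLeft, Equiv.piCongrLeft_apply_apply]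
  exact lintegral_fin_nat_prod_eq_prod fun i => hf _

theorem MeasureTheory.Measure.pi_withDensity {ι : Type*} [Fintype ι] {E : ι → Type*}
    {mE : ∀ i, MeasurableSpace (E i)} {μ : (i : ι) → Measure (E i)} [∀ i, SigmaFinite (μ i)]
    {f : (i : ι) → E i → ℝ≥0∞} (hf : ∀ i, Measurable (f i))
    [∀ i, SigmaFinite ((μ i).withDensity (f i))] :
    Measure.pi (fun i => (μ i).withDensity (f i)) =
      (Measure.pi μ).withDensity fun x => ∏ i, f i (x i) := by
  refine (Measure.pi_eq fun s hs => ?_)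
  rw [withDensity_apply _ (MeasurableSet.univ_pi hs),
    ← lintegral_indicator (MeasurableSet.univ_pi hs)]
  have : ∀ x : (i : ι) → E i, (Set.univ.pi s).indicator (fun x => ∏ i, f i (x i)) x =
      ∏ i, (s i).indicator (f i) (x i) := by
    intro x
    by_cases h : x ∈ Set.univ.pi s
    · rw [Set.indicator_of_mem h]
      exact Finset.prod_congr rfl fun i _ => (Set.indicator_of_mem (h i trivial) _).symm
    · rw [Set.indicator_of_notMem h]
      simp only [Set.mem_pi, Set.mem_univ, true_imp_iff, not_forall] at h
      obtain ⟨i, hi⟩ := h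
      exact (Finset.prod_eq_zero (Finset.mem_univ i) (Set.indicator_of_notMem hi _)).symm
  simp_rw [this]
  rw [lintegral_fintype_prod_eq_prod fun i => (hf i).indicator (hs i)]
  refine Finset.prod_congr rfl fun i _ => ?_
  rw [lintegral_indicator (hs i), withDensity_apply _ (hs i)]

theorem MeasureTheory.MeasurePreserving.withDensity_map {α β : Type*} [MeasurableSpace α] [MeasurableSpace β]
    {μ : Measure α} {ν : Measure β} {g : α → β} (hg : MeasurePreserving g μ ν) {f : β → ℝ≥0∞}
    (hf : Measurable f) : (μ.withDensity (f ∘ g)).map g = ν.withDensity f := by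
  ext s hs
  rw [Measure.map_apply hg.measurable hs, withDensity_apply _ (hg.measurable hs),
    withDensity_apply _ hs, ← hg.setLIntegral_comp_preimage hs hf]
  rfl

/-! ### The density of a centred Gaussian -/

section Gaussian
variable {ι : Type*} [Fintype ι]
open Matrix

theorem stdGaussian_eq_withDensity_volume :
    stdGaussian (EuclideanSpace ℝ ι) = volume.withDensity fun x : EuclideanSpace ℝ ι =>
      ENNReal.ofReal ((√(2 * Real.pi))⁻¹ ^ Fintype.card ι * Real.exp (-(x ⬝ᵥ x) / 2)) := by
  rw [← map_pi_eq_stdGaussian]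
  have h : SigmaFinite ((volume : Measure ℝ).withDensity (gaussianPDF 0 1)) := by
    rw [← gaussianReal_of_var_ne_zero _ one_ne_zero]; infer_instance
  rw [gaussianReal_of_var_ne_zero _ one_ne_zero,
    Measure.pi_withDensity fun _ => measurable_gaussianPDF 0 1,
    ← (PiLp.volume_preserving_toLp ι).withDensity_map (by fun_prop)]
  congr 2
  ext x
  simp only [Function.comp, gaussianPDF, gaussianPDFReal]
  rw [← ENNReal.ofReal_prod_of_nonneg (fun _ _ => by positivity), Finset.prod_mul_distrib,
    ← Real.exp_sum]
  simp [dotProduct, Finset.sum_neg_distrib, Finset.sum_div, pow_two, neg_div]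

variable [DecidableEq ι]

/-- The density of `N(0, S)` with respect to the standard Gaussian. -/
noncomputable def gaussTilt (S : Matrix ι ι ℝ) (x : EuclideanSpace ℝ ι) : ℝ :=
  (√S.det)⁻¹ * Real.exp (-(x ⬝ᵥ (S⁻¹ - 1) *ᵥ x) / 2)

theorem gaussTilt_nonneg (S : Matrix ι ι ℝ) (x : EuclideanSpace ℝ ι) : 0 ≤ gaussTilt S x := by
  unfold gaussTilt; positivity

theorem measurable_gaussTilt (S : Matrix ι ι ℝ) : Measurable (gaussTilt S) := by
  unfold gaussTilt
  refine Continuous.measurable ?_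
  fun_prop

-- Change of variables along $R=\sqrt S$: the image of the standard Gaussian has Lebesgue density
-- $(\det R)^{-1}\gamma(R^{-1}x)$, and $|R^{-1}x|^2=x^{\mathsf T}S^{-1}x$ is split as
-- $|x|^2+x^{\mathsf T}(S^{-1}-1)x$ to factor out $\gamma$.
open scoped MatrixOrder in
theorem multivariateGaussian_zero_eq_withDensity {S : Matrix ι ι ℝ} (hS : S.PosDef) :
    multivariateGaussian 0 S = (stdGaussian (EuclideanSpace ℝ ι)).withDensity fun x =>
      ENNReal.ofReal (gaussTilt S x) := by
  set R := CFC.sqrt S with hR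
  have hRR : R * R = S := CFC.sqrt_mul_sqrt_self _ hS.posSemidef.nonneg
  have hRp : R.PosSemidef := Matrix.nonneg_iff_posSemidef.1 (CFC.sqrt_nonneg S)
  have hRt : Rᵀ = R := hRp.isHermitian
  have hdet : R.det * R.det = S.det := by rw [← Matrix.det_mul, hRR]
  have hSdet := hS.det_pos
  have hR0 : R.det ≠ 0 := by rintro h; rw [h] at hdet; linarith [mul_zero (0 : ℝ)]
  have hRpos : 0 < R.det := lt_of_le_of_ne hRp.det_nonneg hR0.symm
  have hsqrt : √S.det = R.det := by rw [← hdet, Real.sqrt_mul_self hRpos.le]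
  have hu : IsUnit R.det := hR0.isUnit
  set L := toEuclideanCLM (n := ι) (𝕜 := ℝ) R with hL
  have hmp : MeasurePreserving L volume
      (ENNReal.ofReal (R.det)⁻¹ • (volume : Measure (EuclideanSpace ℝ ι))) := by
    refine ⟨L.continuous.measurable, ?_⟩
    have hd : LinearMap.det (L : EuclideanSpace ℝ ι →ₗ[ℝ] EuclideanSpace ℝ ι) = R.det := by
      rw [hL, coe_toEuclideanCLM_eq_toEuclideanLin]; exact LinearMap.det_toLpLin 2 R
    have := Measure.map_linearMap_addHaar_eq_smul_addHaar
      (volume : Measure (EuclideanSpace ℝ ι)) (f := (L : _ →ₗ[ℝ] _)) (by rwa [hd])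
    rw [hd, abs_of_pos (inv_pos.2 hRpos)] at this
    exact this
  rw [multivariateGaussian, stdGaussian_eq_withDensity_volume]
  simp only [zero_add]
  set γ : EuclideanSpace ℝ ι → ℝ≥0∞ := fun x =>
    ENNReal.ofReal ((√(2 * Real.pi))⁻¹ ^ Fintype.card ι * Real.exp (-(x ⬝ᵥ x) / 2)) with hγ
  have hγm : Measurable γ := by
    refine ENNReal.measurable_ofReal.comp (Continuous.measurable ?_); fun_prop
  have hγL : γ = (γ ∘ toEuclideanCLM (n := ι) (𝕜 := ℝ) R⁻¹) ∘ L := by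
    ext x
    simp only [Function.comp, hL]
    rw [← mul_apply_eq_comp, ← map_mul, Matrix.nonsing_inv_mul _ hu, map_one]
    rfl
  have hmeas : Measurable (γ ∘ toEuclideanCLM (n := ι) (𝕜 := ℝ) R⁻¹) :=
    hγm.comp (ContinuousLinearMap.continuous _).measurable
  have hg : Measurable fun x : EuclideanSpace ℝ ι => ENNReal.ofReal (gaussTilt S x) :=
    ENNReal.measurable_ofReal.comp (measurable_gaussTilt S)
  rw [← withDensity_mul _ hγm hg]
  conv_lhs => rw [hγL]
  rw [hmp.withDensity_map hmeas, withDensity_smul_measure, ← withDensity_smul _ hmeas]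
  congr 1
  ext x
  simp only [Pi.smul_apply, Function.comp, smul_eq_mul, Pi.mul_apply, hγ, gaussTilt, hsqrt,
    ofLp_toEuclideanCLM]
  rw [← ENNReal.ofReal_mul (by positivity), ← ENNReal.ofReal_mul (by positivity)]
  congr 1
  have hq : (R⁻¹ *ᵥ x.ofLp) ⬝ᵥ (R⁻¹ *ᵥ x.ofLp) = x.ofLp ⬝ᵥ x.ofLp +
      x.ofLp ⬝ᵥ (S⁻¹ - 1) *ᵥ x.ofLp := by
    rw [Matrix.sub_mulVec, Matrix.one_mulVec, dotProduct_sub, add_sub_cancel,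
      Matrix.dotProduct_mulVec, Matrix.vecMul_mulVec, ← hRR, Matrix.mul_inv_rev,
      Matrix.transpose_nonsing_inv, hRt, ← Matrix.dotProduct_mulVec]
  rw [hq, neg_add, add_div, Real.exp_add]
  ring

end Gaussian

/-! ### Gaussian integrals of exponentials of quadratic forms -/

section Gaussian
variable {ι : Type*} [Fintype ι] [DecidableEq ι]
open Matrix
open scoped Matrix.Norms.L2Operator

theorem dotProduct_mulVec_le_l2_opNorm (M : Matrix ι ι ℝ) (x : ι → ℝ) :
    x ⬝ᵥ M *ᵥ x ≤ ‖M‖ * (x ⬝ᵥ x) := by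
  have h1 := inner_toEuclideanCLM M (WithLp.toLp 2 x) (WithLp.toLp 2 x)
  have h2 := real_inner_le_norm (WithLp.toLp 2 x) (toEuclideanCLM (𝕜 := ℝ) M (WithLp.toLp 2 x))
  have h3 := (toEuclideanCLM (n := ι) (𝕜 := ℝ) M).le_opNorm (WithLp.toLp 2 x)
  have h4 : x ⬝ᵥ x = ‖WithLp.toLp 2 x‖ * ‖WithLp.toLp 2 x‖ := by
    rw [← pow_two, EuclideanSpace.real_norm_sq_eq]; simp [dotProduct, pow_two]
  rw [← cstar_norm_def] at h3
  rw [h4]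
  simp only at h1
  rw [← h1]
  nlinarith [norm_nonneg (WithLp.toLp 2 x)]

theorem posDef_one_sub_of_l2_opNorm_lt_one {M : Matrix ι ι ℝ} (hM : M.IsHermitian)
    (h : ‖M‖ < 1) : (1 - M).PosDef := by
  refine PosDef.of_dotProduct_mulVec_pos (isHermitian_one.sub hM) fun x hx => ?_
  have h1 := dotProduct_mulVec_le_l2_opNorm M x
  have h2 : 0 < x ⬝ᵥ x := by
    have := dotProduct_star_self_pos_iff (v := x) |>.2 hx
    simpa using this
  simp only [star_trivial, sub_mulVec, one_mulVec, dotProduct_sub]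
  nlinarith

/-- This is the total mass 1 of $N(0,(1-K)^{-1})$, read through its density with respect to the
standard Gaussian. -/
theorem lintegral_exp_quadraticForm_stdGaussian {K : Matrix ι ι ℝ} (hK : (1 - K).PosDef) :
    ∫⁻ x, ENNReal.ofReal (Real.exp ((x.ofLp ⬝ᵥ K *ᵥ x.ofLp) / 2))
      ∂(stdGaussian (EuclideanSpace ℝ ι)) = ENNReal.ofReal (√(1 - K).det)⁻¹ := by
  have hS := hK.inv
  have h1 : (multivariateGaussian 0 (1 - K)⁻¹) Set.univ = 1 := measure_univ
  have hp := hK.det_pos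
  have hu : IsUnit (1 - K).det := hp.ne'.isUnit
  have ht : ∀ x : EuclideanSpace ℝ ι, gaussTilt (1 - K)⁻¹ x =
      √(1 - K).det * Real.exp ((x.ofLp ⬝ᵥ K *ᵥ x.ofLp) / 2) := by
    intro x
    rw [gaussTilt, nonsing_inv_nonsing_inv _ hu, det_nonsing_inv, Ring.inverse_eq_inv,
      Real.sqrt_inv, inv_inv]
    congr 3
    rw [sub_sub_cancel_left, neg_mulVec, dotProduct_neg, neg_neg]
  rw [multivariateGaussian_zero_eq_withDensity hS, withDensity_apply _ MeasurableSet.univ,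
    setLIntegral_univ] at h1
  simp_rw [ht, ENNReal.ofReal_mul (Real.sqrt_nonneg _)] at h1
  rw [lintegral_const_mul' _ _ ENNReal.ofReal_ne_top] at h1
  rw [mul_comm] at h1
  rw [ENNReal.eq_inv_of_mul_eq_one_left h1,
    ENNReal.ofReal_inv_of_pos (Real.sqrt_pos.2 hp)]

theorem posDef_one_add_of_l2_opNorm_lt_one {A : Matrix ι ι ℝ} (hA : A.IsHermitian)
    (h : ‖A‖ < 1) : (1 + A).PosDef := by
  rw [← sub_neg_eq_add]
  exact posDef_one_sub_of_l2_opNorm_lt_one hA.neg (by rwa [norm_neg])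

/-- The eigenvalues of $1+A$ lie in $(0,2)$. Algebraically, the matrix is the congruence of
$\frac12(1-A^2)$ by $(1+A)^{-1}$. Adding two such bounds gives positivity of
$(1+A)^{-1}+(1+B)^{-1}-1$ although $A$ and $B$ need not commute. -/
theorem posDef_inv_one_add_sub_half {A : Matrix ι ι ℝ} (hA : A.IsHermitian) (h : ‖A‖ < 1) :
    ((1 + A)⁻¹ - (1 / 2 : ℝ) • (1 : Matrix ι ι ℝ)).PosDef := by
  have hX := posDef_one_add_of_l2_opNorm_lt_one hA h
  have hu : IsUnit (1 + A).det := hX.det_pos.ne'.isUnit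
  have hsq : ‖A * A‖ < 1 := (norm_mul_le _ _).trans_lt (by nlinarith [norm_nonneg A])
  have h1 := (posDef_one_sub_of_l2_opNorm_lt_one (by
    rw [IsHermitian, conjTranspose_mul, hA.eq]) hsq).smul
    (by norm_num : (0 : ℝ) < 1 / 2)
  have hinj : Function.Injective ((1 + A)⁻¹).mulVec :=
    mulVec_injective_of_isUnit ((isUnit_nonsing_inv_iff).2 hX.isUnit)
  have h2 := h1.conjTranspose_mul_mul_same hinj
  rw [hX.inv.isHermitian.eq] at h2
  convert h2 using 1
  have e : (1 / 2 : ℝ) • (1 - A * A) =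
      (1 + A) - (1 / 2 : ℝ) • ((1 + A) * (1 + A)) := by
    have : (1 + A) = (1 / 2 : ℝ) • ((1 + A) + (1 + A)) := by module
    conv_rhs => rw [this]
    simp only [mul_add, add_mul, mul_one, one_mul, ← smul_sub, smul_mul_assoc, mul_smul_comm]
    module
  rw [e, mul_sub, sub_mul, nonsing_inv_mul _ hu, one_mul, mul_smul_comm, smul_mul_assoc,
    ← mul_assoc, nonsing_inv_mul _ hu, one_mul, mul_nonsing_inv _ hu]

/-- The product of the tilts is again the exponential of a quadratic form, and the determinants
combine through $(1+A)\,\bigl((1+A)^{-1}+(1+B)^{-1}-1\bigr)\,(1+B)=1-AB$. -/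
theorem lintegral_gaussTilt_mul_gaussTilt {A B : Matrix ι ι ℝ} (hA : A.IsHermitian)
    (hB : B.IsHermitian) (hA1 : ‖A‖ < 1) (hB1 : ‖B‖ < 1) :
    ∫⁻ x, ENNReal.ofReal (gaussTilt (1 + A) x * gaussTilt (1 + B) x)
      ∂(stdGaussian (EuclideanSpace ℝ ι)) = ENNReal.ofReal (√(1 - A * B).det)⁻¹ := by
  have hX := posDef_one_add_of_l2_opNorm_lt_one hA hA1
  have hY := posDef_one_add_of_l2_opNorm_lt_one hB hB1
  have huX : IsUnit (1 + A).det := hX.det_pos.ne'.isUnit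
  have huY : IsUnit (1 + B).det := hY.det_pos.ne'.isUnit
  set K : Matrix ι ι ℝ := 1 + 1 - (1 + A)⁻¹ - (1 + B)⁻¹ with hKdef
  have hK : (1 - K).PosDef := by
    convert (posDef_inv_one_add_sub_half hA hA1).add (posDef_inv_one_add_sub_half hB hB1) using 1
    rw [hKdef]; module
  have hdet : (1 + A).det * (1 - K).det * (1 + B).det = (1 - A * B).det := by
    rw [← det_mul, ← det_mul]
    congr 1
    have : 1 - K = (1 + A)⁻¹ + (1 + B)⁻¹ - 1 := by rw [hKdef]; abel
    calc (1 + A) * (1 - K) * (1 + B) = (1 + A) * (1 + A)⁻¹ * (1 + B)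
          + (1 + A) * ((1 + B)⁻¹ * (1 + B)) - (1 + A) * (1 + B) := by
          rw [this]; generalize (1 + A)⁻¹ = X; generalize (1 + B)⁻¹ = Y; noncomm_ring
      _ = 1 - A * B := by
          rw [mul_nonsing_inv _ huX, nonsing_inv_mul _ huY]; noncomm_ring
  have ht : ∀ x : EuclideanSpace ℝ ι, gaussTilt (1 + A) x * gaussTilt (1 + B) x =
      ((√(1 + A).det)⁻¹ * (√(1 + B).det)⁻¹) * Real.exp ((x.ofLp ⬝ᵥ K *ᵥ x.ofLp) / 2) := by
    intro x
    rw [gaussTilt, gaussTilt, mul_mul_mul_comm, ← Real.exp_add]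
    congr 2
    simp only [hKdef, sub_mulVec, add_mulVec, dotProduct_sub, dotProduct_add]
    ring
  simp_rw [ht, ENNReal.ofReal_mul (show (0 : ℝ) ≤ (√(1 + A).det)⁻¹ * (√(1 + B).det)⁻¹ by positivity)]
  rw [lintegral_const_mul' _ _ ENNReal.ofReal_ne_top, lintegral_exp_quadraticForm_stdGaussian hK,
    ← ENNReal.ofReal_mul (by positivity), ← hdet, Real.sqrt_mul (mul_pos hX.det_pos hK.det_pos).le,
    Real.sqrt_mul hX.det_pos.le, mul_inv, mul_inv]
  congr 1
  ring

end Gaussian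

/-! ### Determinant expansions -/

section Determinant
variable {ι : Type*} [Fintype ι] [DecidableEq ι]
open Matrix
open scoped Matrix.Norms.L2Operator

theorem abs_trace_le_card_mul_l2_opNorm (X : Matrix ι ι ℝ) :
    |X.trace| ≤ Fintype.card ι * ‖X‖ := by
  have key : ∀ Y : Matrix ι ι ℝ, Y.trace ≤ Fintype.card ι * ‖Y‖ := by
    intro Y
    rw [trace, ← nsmul_eq_mul, ← Finset.card_univ]
    refine Finset.sum_le_card_nsmul _ _ _ fun i _ => ?_
    have := dotProduct_mulVec_le_l2_opNorm Y (Pi.single i 1)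
    simpa using this
  refine abs_le.2 ⟨?_, key X⟩
  have := key (-X)
  rw [trace_neg, norm_neg] at this
  linarith

theorem l2_opNorm_sq_le_sum_sq (K : Matrix ι ι ℝ) : ‖K‖ ^ 2 ≤ ∑ i, ∑ j, K i j ^ 2 := by
  have h0 : 0 ≤ ∑ i, ∑ j, K i j ^ 2 := by positivity
  have : ‖K‖ ≤ √(∑ i, ∑ j, K i j ^ 2) := by
    rw [cstar_norm_def]
    refine ContinuousLinearMap.opNorm_le_bound _ (Real.sqrt_nonneg _) fun x => ?_
    rw [EuclideanSpace.norm_eq, EuclideanSpace.norm_eq, ← Real.sqrt_mul h0]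
    refine Real.sqrt_le_sqrt ?_
    rw [Finset.sum_mul]
    refine Finset.sum_le_sum fun i _ => ?_
    simp only [ofLp_toEuclideanCLM, Real.norm_eq_abs, sq_abs, mulVec, dotProduct]
    exact Finset.sum_mul_sq_le_sq_mul_sq _ _ _
  calc ‖K‖ ^ 2 ≤ √(∑ i, ∑ j, K i j ^ 2) ^ 2 := by gcongr
    _ = _ := Real.sq_sqrt h0

namespace Matrix.IsHermitian
variable {S : Matrix ι ι ℝ} (hS : S.IsHermitian)
include hS

theorem det_one_sub_eq_prod_eigenvalues : (1 - S).det = ∏ i, (1 - hS.eigenvalues i) := by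
  have := Matrix.eval_charpoly S 1
  rw [hS.charpoly_eq, Polynomial.eval_prod] at this
  simpa using this.symm

theorem trace_sq_eq_sum_eigenvalues : (S * S).trace = ∑ i, hS.eigenvalues i ^ 2 := by
  have h := hS.spectral_theorem
  have : S * S = Unitary.conjStarAlgAut ℝ _ hS.eigenvectorUnitary
      (diagonal hS.eigenvalues * diagonal hS.eigenvalues) := by
    conv_lhs => rw [h]
    rw [map_mul]; rfl
  rw [this, Unitary.conjStarAlgAut_apply, trace_mul_cycle, Unitary.coe_star_mul_self, one_mul,
    diagonal_mul_diagonal, trace_diagonal]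
  simp [pow_two]

theorem abs_eigenvalues_le (i : ι) : |hS.eigenvalues i| ≤ ‖S‖ := by
  have : Nonempty ι := ⟨i⟩
  exact spectrum.norm_le_norm_of_mem (hS.eigenvalues_mem_spectrum_real i)

/-- Eigenvalue by eigenvalue, $\log(1-u)\ge -u-2u^2$ for $|u|\le\frac12$. The error involves no
dimension, which matters for forms indexed by the roughly $d^2/2$ entries of $A$. -/
theorem exp_le_det_one_sub (h : ‖S‖ ≤ 1 / 2) :
    Real.exp (-S.trace - 2 * (S * S).trace) ≤ (1 - S).det := by
  rw [hS.det_one_sub_eq_prod_eigenvalues, hS.trace_sq_eq_sum_eigenvalues,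
    hS.trace_eq_sum_eigenvalues, Finset.mul_sum, ← Finset.sum_neg_distrib,
    ← Finset.sum_sub_distrib, Real.exp_sum]
  refine Finset.prod_le_prod (fun _ _ => (Real.exp_pos _).le) fun i _ => ?_
  have hu := (hS.abs_eigenvalues_le i).trans h
  set u := hS.eigenvalues i
  have hu' := abs_le.1 hu
  rw [← Real.le_log_iff_exp_le (by linarith)]
  have := Real.abs_log_sub_add_sum_range_le (x := u) (by linarith) 1
  have h2 : |u| ^ 2 / (1 - |u|) ≤ 2 * u ^ 2 := by
    rw [div_le_iff₀ (by linarith), sq_abs]; nlinarith [sq_nonneg u]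
  have h3 := (abs_le.1 this).1
  simp at h3 ⊢
  simp at h2
  linarith

/-- The same with one more Taylor term: the exact coefficient $\frac12$ of the quadratic part is
bought with an error proportional to the dimension. -/
theorem exp_le_det_one_sub_of_cubic (h : ‖S‖ ≤ 1 / 2) :
    Real.exp (-S.trace - (S * S).trace / 2 - 2 * Fintype.card ι * ‖S‖ ^ 3) ≤ (1 - S).det := by
  have e : -S.trace - (S * S).trace / 2 - 2 * Fintype.card ι * ‖S‖ ^ 3 =
      ∑ i, (-hS.eigenvalues i - hS.eigenvalues i ^ 2 / 2 - 2 * ‖S‖ ^ 3) := by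
    rw [hS.trace_sq_eq_sum_eigenvalues, hS.trace_eq_sum_eigenvalues]
    simp [Finset.sum_sub_distrib, Finset.sum_div, Finset.sum_neg_distrib]
    ring
  rw [e, hS.det_one_sub_eq_prod_eigenvalues, Real.exp_sum]
  refine Finset.prod_le_prod (fun _ _ => (Real.exp_pos _).le) fun i _ => ?_
  have hu := (hS.abs_eigenvalues_le i).trans h
  have hu3 := pow_le_pow_left₀ (abs_nonneg _) (hS.abs_eigenvalues_le i) 3
  set u := hS.eigenvalues i
  have hu' := abs_le.1 hu
  rw [← Real.le_log_iff_exp_le (by linarith)]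
  have := Real.abs_log_sub_add_sum_range_le (x := u) (by linarith) 2
  have h2 : |u| ^ (2 + 1) / (1 - |u|) ≤ 2 * |u| ^ 3 := by
    have := pow_nonneg (abs_nonneg u) 3
    rw [div_le_iff₀ (by linarith)]; norm_num; nlinarith
  have h3 := (abs_le.1 this).1
  simp only [Finset.sum_range_succ, Finset.sum_range_zero] at h3
  norm_num at h3
  norm_num at h2
  linarith

end Matrix.IsHermitian

/-- The product $AB$ is not symmetric, so the spectral bound is applied to $S$ defined by
$1-S=(1-M)(1-M)^{\mathsf T}$, whose determinant is $\det(1-M)^2$. In $\mathrm{tr}S+\mathrm{tr}S^2/2$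
the contributions of $MM^{\mathsf T}$ cancel, up to the cubic remainder $R$. -/
theorem inv_sqrt_det_one_sub_le {M : Matrix ι ι ℝ} (h : ‖M‖ ≤ 1 / 6) :
    (√(1 - M).det)⁻¹ ≤
      Real.exp (M.trace / 2 + (M * M).trace / 4 + 15 * (Fintype.card ι * ‖M‖ ^ 3)) := by
  set m := ‖M‖ with hm
  have hm0 : 0 ≤ m := norm_nonneg M
  have hMt : ‖Mᵀ‖ = m := by rw [← conjTranspose_eq_transpose_of_trivial, l2_opNorm_conjTranspose]
  have hMM : ‖M * Mᵀ‖ ≤ m ^ 2 := (norm_mul_le _ _).trans (by rw [hMt, pow_two])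
  set S := M + Mᵀ - M * Mᵀ with hS
  have hSh : S.IsHermitian := by
    rw [IsHermitian, conjTranspose_eq_transpose_of_trivial, hS]
    simp [add_comm]
  have hSn : ‖S‖ ≤ 3 * m := by
    calc ‖S‖ ≤ ‖M‖ + ‖Mᵀ‖ + ‖M * Mᵀ‖ := (norm_sub_le _ _).trans (by gcongr; exact norm_add_le _ _)
      _ ≤ 3 * m := by rw [hMt]; nlinarith
  have hdet : (1 - S).det = (1 - M).det ^ 2 := by
    have e : 1 - S = (1 - M) * (1 - M)ᵀ := by
      rw [hS, transpose_sub, transpose_one]; noncomm_ring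
    rw [e, det_mul, det_transpose, pow_two]
  have hmain := hSh.exp_le_det_one_sub_of_cubic (hSn.trans (by linarith))
  have htr1 : S.trace = 2 * M.trace - (M * Mᵀ).trace := by
    rw [hS, trace_sub, trace_add, trace_transpose]; ring
  set R := (M + Mᵀ) * (M * Mᵀ) + M * Mᵀ * (M + Mᵀ) - M * Mᵀ * (M * Mᵀ) with hR
  have hT : ‖M + Mᵀ‖ ≤ 2 * m := (norm_add_le _ _).trans (by rw [hMt]; linarith)
  have hRn : ‖R‖ ≤ 5 * m ^ 3 := by
    calc ‖R‖ ≤ ‖M + Mᵀ‖ * ‖M * Mᵀ‖ + ‖M * Mᵀ‖ * ‖M + Mᵀ‖ + ‖M * Mᵀ‖ * ‖M * Mᵀ‖ := by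
          refine (norm_sub_le _ _).trans ?_
          gcongr
          · exact (norm_add_le _ _).trans (by gcongr <;> exact norm_mul_le _ _)
          · exact norm_mul_le _ _
      _ ≤ 2 * m * m ^ 2 + m ^ 2 * (2 * m) + m ^ 2 * m ^ 2 := by gcongr
      _ ≤ 5 * m ^ 3 := by nlinarith [pow_nonneg hm0 3]
  have htr2 : (S * S).trace = 2 * (M * M).trace + 2 * (M * Mᵀ).trace - R.trace := by
    have e : S * S = M * M + M * Mᵀ + (Mᵀ * M + Mᵀ * Mᵀ) - R := by rw [hS, hR]; noncomm_ring
    have e2 : (Mᵀ * Mᵀ).trace = (M * M).trace := by rw [← transpose_mul, trace_transpose]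
    rw [e, trace_sub, trace_add, trace_add, trace_add, e2, trace_mul_comm Mᵀ M]
    ring
  have hRt := (abs_le.1 (abs_trace_le_card_mul_l2_opNorm R)).1
  set n : ℝ := (Fintype.card ι : ℝ) with hn
  have hn0 : 0 ≤ n := Nat.cast_nonneg _
  have hS3 : ‖S‖ ^ 3 ≤ 27 * m ^ 3 := by
    calc ‖S‖ ^ 3 ≤ (3 * m) ^ 3 := by gcongr
      _ = _ := by ring
  have hnS := mul_le_mul_of_nonneg_left hS3 hn0
  have hnR := mul_le_mul_of_nonneg_left hRn hn0
  have hnm : 0 ≤ n * m ^ 3 := by positivity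
  -- After doubling twice, the constant 15 allows an error $60\,nm^3$; the cubic bound for $S$ uses
  -- $2\cdot27$ of it and $\mathrm{tr}R/2$ uses $5/2$.
  have hsq : Real.exp (-(2 * (M.trace / 2 + (M * M).trace / 4 + 15 * (n * m ^ 3)))) ^ 2 ≤
      (1 - M).det ^ 2 := by
    rw [← hdet, ← Real.exp_nat_mul]
    refine le_trans (Real.exp_le_exp.2 ?_) hmain
    rw [htr1, htr2]
    push_cast
    linarith
  -- Only the square of the determinant has been controlled. If the determinant is not positive, the
  -- left side is 0 by the conventions for `√` and the inverse.
  rcases le_or_gt (1 - M).det 0 with hd | hd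
  · rw [Real.sqrt_eq_zero_of_nonpos hd, _root_.inv_zero]; exact (Real.exp_pos _).le
  have h3 := Real.sqrt_le_sqrt ((sq_le_sq₀ (Real.exp_pos _).le hd.le).1 hsq)
  rw [← Real.exp_half] at h3
  rw [inv_le_comm₀ (Real.sqrt_pos.2 hd) (Real.exp_pos _), ← Real.exp_neg]
  rwa [neg_div, mul_div_cancel_left₀ _ (two_ne_zero' ℝ)] at h3

/-- The integral equals $\det(1-2K)^{-1/2}$. The Frobenius hypothesis forces $\|2K\|\le\frac12$, so
the dimension-free determinant bound applies. -/
theorem lintegral_exp_quadraticForm_le {K : Matrix ι ι ℝ} (hK : K.IsHermitian)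
    (h : ∑ i, ∑ j, K i j ^ 2 ≤ 1 / 16) :
    ∫⁻ x, ENNReal.ofReal (Real.exp (x.ofLp ⬝ᵥ K *ᵥ x.ofLp))
      ∂(stdGaussian (EuclideanSpace ℝ ι)) ≤
      ENNReal.ofReal (Real.exp (K.trace + 4 * ∑ i, ∑ j, K i j ^ 2)) := by
  have htr : ∑ i, ∑ j, K i j ^ 2 = (K * K).trace := by
    simp only [trace, diag, mul_apply, pow_two]
    refine Finset.sum_congr rfl fun i _ => Finset.sum_congr rfl fun j _ => ?_
    have := hK.apply i j
    simp only [star_trivial] at this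
    rw [this]
  have hn : ‖(2 : ℝ) • K‖ ≤ 1 / 2 := by
    have := (l2_opNorm_sq_le_sum_sq K).trans h
    rw [norm_smul, Real.norm_ofNat]
    nlinarith [norm_nonneg K]
  have hH : ((2 : ℝ) • K).IsHermitian := by
    rw [IsHermitian, conjTranspose_smul, hK.eq]; simp
  have h1 := lintegral_exp_quadraticForm_stdGaussian
    (posDef_one_sub_of_l2_opNorm_lt_one hH (by linarith))
  have h2 := hH.exp_le_det_one_sub hn
  have e : ∀ x : EuclideanSpace ℝ ι, (x.ofLp ⬝ᵥ ((2 : ℝ) • K) *ᵥ x.ofLp) / 2 =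
      x.ofLp ⬝ᵥ K *ᵥ x.ofLp := by
    intro x; rw [smul_mulVec, dotProduct_smul, smul_eq_mul]; ring
  simp_rw [e] at h1
  rw [h1, htr]
  refine ENNReal.ofReal_le_ofReal ?_
  rw [show K.trace + 4 * (K * K).trace =
    -((-((2 : ℝ) • K).trace - 2 * ((2 : ℝ) • K * (2 : ℝ) • K).trace) / 2) by
      simp [trace_smul]; ring, Real.exp_neg, Real.exp_half]
  gcongr

end Determinant

/-! ### The one-sample chi-squared and its first-order cancellation -/

theorem Real.exp_le_one_add_add_sq_mul_exp {u U : ℝ} (h : |u| ≤ U) :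
    Real.exp u ≤ 1 + u + u ^ 2 * Real.exp U := by
  have := Complex.norm_exp_sub_sum_le_norm_mul_exp (u : ℂ) 2
  simp only [Finset.sum_range_succ, Finset.sum_range_zero, Complex.norm_real, Real.norm_eq_abs] at this
  norm_num at this
  rw [← Complex.ofReal_exp, ← Complex.ofReal_one, ← Complex.ofReal_add, ← Complex.ofReal_sub,
    Complex.norm_real, Real.norm_eq_abs] at this
  have h1 := (abs_le.1 this).2
  have h2 : u ^ 2 * Real.exp |u| ≤ u ^ 2 * Real.exp U := by gcongr
  linarith

namespace RobustCov
open Matrix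
open scoped Matrix.Norms.L2Operator

/-- The chi-squared inner product of two noisy Gaussians with respect to the standard one. -/
noncomputable def noisyChiSq {d : ℕ} (A B : Matrix (Fin d) (Fin d) ℝ) : ℝ :=
  81 / 100 * (√(1 - A * B).det)⁻¹ + 18 / 100 * (√(1 - (-9 : ℝ) • (A * B)).det)⁻¹ +
    1 / 100 * (√(1 - (81 : ℝ) • (A * B)).det)⁻¹

theorem noisyChiSq_nonneg {d : ℕ} (A B : Matrix (Fin d) (Fin d) ℝ) : 0 ≤ noisyChiSq A B := by
  unfold noisyChiSq; positivity

/-- The cancellation behind the construction: the weights $.81,.18,.01$ give total coefficient $0$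
to $x$, $81/4$ to $y$ and $1$ to $e$. The constants are generous: $3(6561/4)^2\le10^7$ in the
quadratic remainder, and $81/2+6561/4+1\le10^4$ in the exponent. -/
theorem exp_mixture_le {X x y e : ℝ} (hx : |x| ≤ X) (hy : |y| ≤ X) (he0 : 0 ≤ e) (he : e ≤ X) :
    81 / 100 * Real.exp (x / 2 + y / 4 + e) + 18 / 100 * Real.exp (-9 * x / 2 + 81 * y / 4 + e) +
      1 / 100 * Real.exp (81 * x / 2 + 6561 * y / 4 + e) ≤
    1 + 81 / 4 * y + e + 10 ^ 7 * Real.exp (10 ^ 4 * X) * (x ^ 2 + y ^ 2 + e ^ 2) := by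
  have hx' := abs_le.1 hx
  have hy' := abs_le.1 hy
  have key : ∀ s t : ℝ, |s| ≤ 81 / 2 → |t| ≤ 6561 / 4 →
      Real.exp (s * x + t * y + e) ≤ 1 + (s * x + t * y + e) +
        10 ^ 7 * (x ^ 2 + y ^ 2 + e ^ 2) * Real.exp (10 ^ 4 * X) := by
    intro s t hs ht
    have hU : |s * x + t * y + e| ≤ 10 ^ 4 * X := by
      have h1 : |s * x| ≤ 81 / 2 * X := by rw [abs_mul]; gcongr
      have h2 : |t * y| ≤ 6561 / 4 * X := by rw [abs_mul]; gcongr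
      have := abs_add_three (s * x) (t * y) e
      rw [abs_of_nonneg he0] at this
      linarith
    refine (Real.exp_le_one_add_add_sq_mul_exp hU).trans ?_
    gcongr
    have hs2 : s ^ 2 ≤ (81 / 2) ^ 2 := sq_le_sq' (by linarith [abs_le.1 hs]) (abs_le.1 hs).2
    have ht2 : t ^ 2 ≤ (6561 / 4) ^ 2 := sq_le_sq' (by linarith [abs_le.1 ht]) (abs_le.1 ht).2
    have h1 : (s * x + t * y + e) ^ 2 ≤ 3 * (s ^ 2 * x ^ 2 + t ^ 2 * y ^ 2 + e ^ 2) := by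
      nlinarith [sq_nonneg (s * x - t * y), sq_nonneg (s * x - e), sq_nonneg (t * y - e)]
    have h2 := mul_le_mul_of_nonneg_right hs2 (sq_nonneg x)
    have h3 := mul_le_mul_of_nonneg_right ht2 (sq_nonneg y)
    nlinarith [sq_nonneg x, sq_nonneg y, sq_nonneg e]
  have k1 := key (1 / 2) (1 / 4) (by norm_num [abs_le]) (by norm_num [abs_le])
  have k2 := key (-9 / 2) (81 / 4) (by norm_num [abs_le]) (by norm_num [abs_le])
  have k3 := key (81 / 2) (6561 / 4) (by norm_num [abs_le]) (by norm_num [abs_le])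
  rw [show 1 / 2 * x + 1 / 4 * y + e = x / 2 + y / 4 + e by ring] at k1
  rw [show -9 / 2 * x + 81 / 4 * y + e = -9 * x / 2 + 81 * y / 4 + e by ring] at k2
  rw [show 81 / 2 * x + 6561 / 4 * y + e = 81 * x / 2 + 6561 * y / 4 + e by ring] at k3
  linarith

/-- With $\|AB\|\le C^2/d$, the squares of $\mathrm{tr}(ABAB)=O(1/d)$ and of the cubic error are
$O(1/d^2)$ and may be discarded. The linear term $\frac{81}4\mathrm{tr}(ABAB)$ must stay: the
pointwise bound $O(1/d)$ is too weak after multiplication by $N$. -/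
theorem exists_noisyChiSq_le (C : ℝ) : ∃ L : ℝ, 0 ≤ L ∧ ∀ᶠ d : ℕ in atTop,
    ∀ A B : Matrix (Fin d) (Fin d) ℝ, ‖A‖ ≤ C / √d → ‖B‖ ≤ C / √d →
      noisyChiSq A B ≤ Real.exp (L * (A * B).trace ^ 2 +
        81 / 4 * (A * B * (A * B)).trace + L / d ^ 2) := by
  set X := C ^ 2 + C ^ 4 + 15 * 81 ^ 3 * C ^ 6 with hX
  set W := 10 ^ 7 * Real.exp (10 ^ 4 * X) with hW
  have hC2 : 0 ≤ C ^ 2 := by positivity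
  have hC4 : 0 ≤ C ^ 4 := by positivity
  have hC6 : 0 ≤ C ^ 6 := by positivity
  have hW0 : 0 ≤ W := by positivity
  have hX0 : 0 ≤ X := by positivity
  -- The summand $W$ serves $x^2$; the rest, $2WX^2+X$, pays for $y^2$, $e^2$ and $e$, which are all
  -- $O(1/d^2)$.
  refine ⟨W * (1 + X ^ 2 + X ^ 2) + X, by positivity, ?_⟩
  have hlarge : ∀ᶠ d : ℕ in atTop, 6 * 81 * C ^ 2 ≤ (d : ℝ) :=
    tendsto_natCast_atTop_atTop.eventually_ge_atTop _
  filter_upwards [hlarge, eventually_ge_atTop 1] with d hd hd1 A B hA hB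
  have hd0 : (1 : ℝ) ≤ d := by exact_mod_cast hd1
  have hdp : (0 : ℝ) < d := by linarith
  set m := C ^ 2 / d with hm
  have hm0 : 0 ≤ m := by positivity
  have hAB : ‖A * B‖ ≤ m := by
    calc ‖A * B‖ ≤ ‖A‖ * ‖B‖ := norm_mul_le _ _
      _ ≤ C / √d * (C / √d) := by
          gcongr; exact (norm_nonneg A).trans hA
      _ = m := by rw [div_mul_div_comm, Real.mul_self_sqrt hdp.le, hm, pow_two]
  have hm6 : 81 * m ≤ 1 / 6 := by
    rw [hm, ← mul_div_assoc, div_le_iff₀ hdp]; linarith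
  have hx : |(A * B).trace| ≤ C ^ 2 := by
    refine (abs_trace_le_card_mul_l2_opNorm _).trans ?_
    rw [Fintype.card_fin]
    calc d * ‖A * B‖ ≤ d * m := by gcongr
      _ = C ^ 2 := by rw [hm]; field_simp
  have hy : |(A * B * (A * B)).trace| ≤ C ^ 4 / d := by
    refine (abs_trace_le_card_mul_l2_opNorm _).trans ?_
    rw [Fintype.card_fin]
    calc d * ‖A * B * (A * B)‖ ≤ d * (m * m) := by
          gcongr; exact (norm_mul_le _ _).trans (by gcongr)
      _ = C ^ 4 / d := by rw [hm]; field_simp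
  set e := 15 * 81 ^ 3 * C ^ 6 / d ^ 2 with he
  have he0 : 0 ≤ e := by positivity
  have hD : ∀ t : ℝ, |t| ≤ 81 → (√(1 - t • (A * B)).det)⁻¹ ≤
      Real.exp (t * (A * B).trace / 2 + t ^ 2 * (A * B * (A * B)).trace / 4 + e) := by
    intro t ht
    have hn : ‖t • (A * B)‖ ≤ 81 * m := by rw [norm_smul, Real.norm_eq_abs]; gcongr
    refine (inv_sqrt_det_one_sub_le (hn.trans hm6)).trans (Real.exp_le_exp.2 ?_)
    have h3 : 15 * (Fintype.card (Fin d) * ‖t • (A * B)‖ ^ 3) ≤ e := by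
      calc 15 * (Fintype.card (Fin d) * ‖t • (A * B)‖ ^ 3) ≤ 15 * (d * (81 * m) ^ 3) := by
            rw [Fintype.card_fin]; gcongr
        _ = e := by rw [he, hm]; field_simp
    have h4 : (t • (A * B) * t • (A * B)).trace = t ^ 2 * (A * B * (A * B)).trace := by
      rw [smul_mul_smul_comm, trace_smul, smul_eq_mul, pow_two]
    rw [h4, trace_smul, smul_eq_mul]
    linarith
  set x := (A * B).trace
  set y := (A * B * (A * B)).trace
  have hCd : C ^ 4 / d ≤ C ^ 4 := div_le_self hC4 hd0
  have heX : e ≤ 15 * 81 ^ 3 * C ^ 6 := div_le_self (by positivity) (by nlinarith)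
  have hmix := exp_mixture_le (X := X) (hx.trans (by rw [hX]; linarith))
    (hy.trans (by rw [hX]; linarith)) he0 (heX.trans (by rw [hX]; linarith))
  have d1 : (√(1 - A * B).det)⁻¹ ≤ Real.exp (x / 2 + y / 4 + e) := by
    have := hD 1 (by norm_num [abs_le])
    rw [one_smul] at this
    exact this.trans_eq (by congr 1; ring)
  have d2 := (hD (-9) (by norm_num [abs_le])).trans_eq
    (show _ = Real.exp (-9 * x / 2 + 81 * y / 4 + e) by congr 1; ring)
  have d3 := (hD 81 (by norm_num [abs_le])).trans_eq
    (show _ = Real.exp (81 * x / 2 + 6561 * y / 4 + e) by congr 1; ring)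
  have hy2 : y ^ 2 ≤ X ^ 2 / d ^ 2 := by
    rw [← div_pow, ← sq_abs y]
    gcongr
    exact hy.trans (by gcongr; rw [hX]; linarith)
  have he1 : e ≤ X / d ^ 2 := by rw [he]; gcongr; rw [hX]; linarith
  have he2 : e ^ 2 ≤ X ^ 2 / d ^ 2 := by
    calc e ^ 2 = e * e := pow_two e
      _ ≤ X / d ^ 2 * X := by gcongr; exact heX.trans (by rw [hX]; linarith)
      _ = X ^ 2 / d ^ 2 := by ring
  have hfin : noisyChiSq A B ≤
      1 + 81 / 4 * y + e + W * (x ^ 2 + y ^ 2 + e ^ 2) := by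
    refine le_trans ?_ hmix
    unfold noisyChiSq
    gcongr
  refine hfin.trans (le_trans ?_ (Real.add_one_le_exp _))
  have hWs : W * (x ^ 2 + y ^ 2 + e ^ 2) ≤ W * (x ^ 2 + X ^ 2 / d ^ 2 + X ^ 2 / d ^ 2) := by gcongr
  have h9 : 0 ≤ (W * (X ^ 2 + X ^ 2) + X) * x ^ 2 := by positivity
  have h10 : 0 ≤ W / (d : ℝ) ^ 2 := by positivity
  have e1 : (W * (1 + X ^ 2 + X ^ 2) + X) / (d : ℝ) ^ 2 =
    W / (d : ℝ) ^ 2 + W * (X ^ 2 / d ^ 2 + X ^ 2 / d ^ 2) + X / d ^ 2 := by ring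
  rw [e1]
  nlinarith

end RobustCov

/-! ### Mixtures over a random parameter and their chi-squared -/

namespace RobustCov

section Mixture
variable {Γ Ω : Type*} [MeasurableSpace Γ] [MeasurableSpace Ω]

/-- The kernel `κ` need have the density only almost everywhere: off the norm event the covariances
may fail to be positive semidefinite. Measurability is supplied by the version with density. -/
theorem bind_eq_withDensity {ν : Measure Γ} [SFinite ν] {P : Measure Ω} [SFinite P]
    {κ : Γ → Measure Ω} {F : Γ → Ω → ℝ≥0∞} (hF : Measurable (Function.uncurry F))
    (hκ : ∀ᵐ γ ∂ν, κ γ = P.withDensity (F γ)) :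
    ν.bind κ = P.withDensity fun ω => ∫⁻ γ, F γ ω ∂ν := by
  have hmeas : Measurable fun γ => P.withDensity (F γ) := by
    refine Measure.measurable_of_measurable_coe _ fun s hs => ?_
    simp_rw [withDensity_apply _ hs]
    exact hF.lintegral_prod_right
  have h : ν.bind κ = ν.bind fun γ => P.withDensity (F γ) := by
    rw [Measure.bind, Measure.bind, Measure.map_congr hκ]
  rw [h]
  ext s hs
  rw [Measure.bind_apply hs hmeas.aemeasurable, withDensity_apply _ hs]
  simp_rw [withDensity_apply _ hs]
  exact lintegral_lintegral_swap hF.aemeasurable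

theorem chiSq_withDensity {P : Measure Ω} [SigmaFinite P] {h : Ω → ℝ≥0∞} (hm : Measurable h)
    [SigmaFinite (P.withDensity h)] :
    chiSq P (P.withDensity h) (P.withDensity h) = ∫⁻ ω, h ω * h ω ∂P := by
  rw [chiSq_eq_of_ac _ _ _ (withDensity_absolutelyContinuous _ _)
    (withDensity_absolutelyContinuous _ _)]
  refine lintegral_congr_ae ?_
  filter_upwards [Measure.rnDeriv_withDensity P hm] with ω hω
  rw [hω]

/-- Integrate $2t\le t^2+1$; this form of Cauchy–Schwarz also covers the value $\infty$. -/
theorem one_le_lintegral_mul_self {P : Measure Ω} [IsProbabilityMeasure P] {h : Ω → ℝ≥0∞}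
    (hm : Measurable h) (h1 : ∫⁻ ω, h ω ∂P = 1) : 1 ≤ ∫⁻ ω, h ω * h ω ∂P := by
  have key : ∀ t : ℝ≥0∞, 2 * t ≤ t * t + 1 := by
    intro t
    induction t with
    | top => simp
    | coe t =>
      norm_cast
      rw [← NNReal.coe_le_coe]
      push_cast
      nlinarith [sq_nonneg ((t : ℝ) - 1)]
  have : 2 * ∫⁻ ω, h ω ∂P ≤ ∫⁻ ω, h ω * h ω ∂P + 1 := by
    rw [← lintegral_const_mul _ hm]
    refine (lintegral_mono fun ω => key (h ω)).trans ?_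
    rw [lintegral_add_right _ measurable_const]
    simp
  rw [h1, mul_one, ← one_add_one_eq_two] at this
  exact (ENNReal.add_le_add_iff_right ENNReal.one_ne_top).1 this

theorem lintegral_mixture_sq {ν : Measure Γ} [SFinite ν] {P : Measure Ω} [SFinite P]
    {F : Γ → Ω → ℝ≥0∞} (hF : Measurable (Function.uncurry F)) :
    ∫⁻ ω, (∫⁻ γ, F γ ω ∂ν) * (∫⁻ γ, F γ ω ∂ν) ∂P =
      ∫⁻ γ, ∫⁻ γ', ∫⁻ ω, F γ ω * F γ' ω ∂P ∂ν ∂ν := by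
  have hFω : ∀ ω, Measurable fun γ => F γ ω := fun ω =>
    hF.comp (f := fun γ => (γ, ω)) (by fun_prop)
  have h1 : ∀ ω, (∫⁻ γ, F γ ω ∂ν) * (∫⁻ γ, F γ ω ∂ν) = ∫⁻ γ, ∫⁻ γ', F γ ω * F γ' ω ∂ν ∂ν := by
    intro ω
    simp_rw [lintegral_const_mul _ (hFω ω), lintegral_mul_const _ (hFω ω)]
  have hm3 : Measurable fun p : (Ω × Γ) × Γ => F p.1.2 p.1.1 * F p.2 p.1.1 :=
    (hF.comp (g := Function.uncurry F) (f := fun p : (Ω × Γ) × Γ => (p.1.2, p.1.1)) (by fun_prop)).mul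
      (hF.comp (g := Function.uncurry F) (f := fun p : (Ω × Γ) × Γ => (p.2, p.1.1)) (by fun_prop))
  simp_rw [h1]
  rw [lintegral_lintegral_swap (f := fun ω γ => ∫⁻ γ', F γ ω * F γ' ω ∂ν)
    hm3.lintegral_prod_right'.aemeasurable]
  refine lintegral_congr fun γ => ?_
  refine lintegral_lintegral_swap (f := fun ω γ' => F γ ω * F γ' ω) (Measurable.aemeasurable ?_)
  exact hm3.comp (f := fun p : Ω × Γ => ((p.1, γ), p.2)) (by fun_prop)

end Mixture

open Matrix

/-- The inverse is not continuous at singular matrices, but written as `det⁻¹ • adjugate` it is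
measurable entry by entry. -/
theorem measurable_gaussTilt_comp {ι Γ : Type*} [Fintype ι] [DecidableEq ι] [TopologicalSpace Γ]
    [MeasurableSpace Γ] [OpensMeasurableSpace Γ] {S : Γ → Matrix ι ι ℝ}
    (hS : Continuous S) :
    Measurable fun p : Γ × EuclideanSpace ℝ ι => gaussTilt (S p.1) p.2 := by
  have hdet : Measurable fun γ => (S γ).det := hS.matrix_det.measurable
  have hinv : ∀ i j, Measurable fun γ => ((S γ)⁻¹ - 1) i j := by
    intro i j
    simp only [Matrix.sub_apply, Matrix.inv_def, Matrix.smul_apply, Ring.inverse_eq_inv, smul_eq_mul]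
    exact (hdet.inv.mul (hS.matrix_adjugate.matrix_elem i j).measurable).sub_const _
  unfold gaussTilt
  simp only [dotProduct, mulVec]
  have h1 : ∀ i j, Measurable fun p : Γ × EuclideanSpace ℝ ι => ((S p.1)⁻¹ - 1) i j :=
    fun i j => (hinv i j).comp measurable_fst
  have h2 : Measurable fun p : Γ × EuclideanSpace ℝ ι => (S p.1).det := hdet.comp measurable_fst
  have h3 : ∀ i, Measurable fun p : Γ × EuclideanSpace ℝ ι => p.2 i := fun i =>
    (by fun_prop : Measurable fun x : EuclideanSpace ℝ ι => x i).comp measurable_snd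
  refine h2.sqrt.inv.mul (Real.measurable_exp.comp (Measurable.div_const (Measurable.neg ?_) _))
  exact Finset.measurable_sum _ fun i _ => (h3 i).mul
    (Finset.measurable_sum _ fun j _ => (h1 i j).mul (h3 j))

variable {d : ℕ}

/-- The density of the noisy Gaussian with respect to the standard one. -/
noncomputable def noisyDensity (A : Matrix (Fin d) (Fin d) ℝ) (x : EuclideanSpace ℝ (Fin d)) : ℝ :=
  9 / 10 * gaussTilt (1 + A) x + 1 / 10 * gaussTilt (1 - (9 : ℝ) • A) x

theorem measurable_noisyDensity (A : Matrix (Fin d) (Fin d) ℝ) : Measurable (noisyDensity A) :=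
  ((measurable_gaussTilt _).const_mul _).add ((measurable_gaussTilt _).const_mul _)

theorem continuous_symMatrix :
    Continuous (symMatrix : ({p : Fin d × Fin d // p.1 < p.2} → ℝ) → Matrix (Fin d) (Fin d) ℝ) := by
  refine continuous_matrix fun i j => ?_
  simp only [symMatrix, Matrix.of_apply]
  split_ifs <;> fun_prop

theorem isHermitian_symMatrix (g : {p : Fin d × Fin d // p.1 < p.2} → ℝ) :
    (symMatrix g).IsHermitian := by
  ext i j
  simp only [symMatrix, conjTranspose_apply, Matrix.of_apply, star_trivial]
  rcases lt_trichotomy i j with h | h | h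
  · rw [dif_neg h.not_gt, dif_pos h, dif_pos h]
  · subst h; simp
  · rw [dif_pos h, dif_neg h.not_gt, dif_pos h]

theorem measurable_noisyDensity_symMatrix : Measurable
    fun p : ({p : Fin d × Fin d // p.1 < p.2} → ℝ) × EuclideanSpace ℝ (Fin d) =>
      noisyDensity (symMatrix p.1) p.2 :=
  ((measurable_gaussTilt_comp (continuous_const.add continuous_symMatrix)).const_mul _).add
    ((measurable_gaussTilt_comp
      (continuous_const.sub (continuous_symMatrix.const_smul (9 : ℝ)))).const_mul _)

theorem measurableSet_normEvent (C₁ C₂ : ℝ) : MeasurableSet (normEvent d C₁ C₂) := by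
  have h : Continuous fun g : {p : Fin d × Fin d // p.1 < p.2} → ℝ =>
      matSpectralNorm (symMatrix g) := by
    have := (toEuclideanCLM (n := Fin d) (𝕜 := ℝ)).toAlgEquiv.toLinearMap.continuous_of_finiteDimensional
    exact continuous_norm.comp (this.comp continuous_symMatrix)
  have h2 : Continuous fun g : {p : Fin d × Fin d // p.1 < p.2} → ℝ =>
      frobeniusNorm (symMatrix g) := by
    unfold frobeniusNorm
    have := fun i j => (continuous_symMatrix (d := d)).matrix_elem i j
    fun_prop
  exact (measurableSet_le h.measurable measurable_const).inter
    (measurableSet_le h2.measurable measurable_const)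

open scoped Matrix.Norms.L2Operator

theorem noisyGaussian_eq_withDensity {A : Matrix (Fin d) (Fin d) ℝ} (h1 : (1 + A).PosDef)
    (h2 : (1 - (9 : ℝ) • A).PosDef) :
    noisyGaussian A = (stdG d).withDensity fun x => ENNReal.ofReal (noisyDensity A x) := by
  have m1 : Measurable fun x => ENNReal.ofReal (gaussTilt (1 + A) x) :=
    ENNReal.measurable_ofReal.comp (measurable_gaussTilt _)
  have m2 : Measurable fun x => ENNReal.ofReal (gaussTilt (1 - (9 : ℝ) • A) x) :=
    ENNReal.measurable_ofReal.comp (measurable_gaussTilt _)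
  rw [noisyGaussian, multivariateGaussian_zero_eq_withDensity h1,
    multivariateGaussian_zero_eq_withDensity h2, stdG, multivariateGaussian_zero_one]
  have e : (fun x => ENNReal.ofReal (noisyDensity A x)) =
      (9 / 10 : ℝ≥0∞) • (fun x => ENNReal.ofReal (gaussTilt (1 + A) x)) +
      (1 / 10 : ℝ≥0∞) • fun x => ENNReal.ofReal (gaussTilt (1 - (9 : ℝ) • A) x) := by
    ext x
    have a1 := gaussTilt_nonneg (1 + A) x
    have a2 := gaussTilt_nonneg (1 - (9 : ℝ) • A) x
    simp only [noisyDensity, Pi.add_apply, Pi.smul_apply, smul_eq_mul]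
    rw [ENNReal.ofReal_add (by positivity) (by positivity), ENNReal.ofReal_mul (by norm_num),
      ENNReal.ofReal_mul (by norm_num), ENNReal.ofReal_div_of_pos (by norm_num),
      ENNReal.ofReal_div_of_pos (by norm_num)]
    norm_num
  rw [e, withDensity_add_left (m1.const_smul _), withDensity_smul _ m1, withDensity_smul _ m2]

theorem noisyDensity_nonneg (A : Matrix (Fin d) (Fin d) ℝ) (x : EuclideanSpace ℝ (Fin d)) :
    0 ≤ noisyDensity A x := by
  have a1 := gaussTilt_nonneg (1 + A) x
  have a2 := gaussTilt_nonneg (1 - (9 : ℝ) • A) x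
  unfold noisyDensity; positivity

theorem lintegral_noisyDensity_mul {A B : Matrix (Fin d) (Fin d) ℝ} (hA : A.IsHermitian)
    (hB : B.IsHermitian) (hA1 : ‖A‖ < 1 / 9) (hB1 : ‖B‖ < 1 / 9) :
    ∫⁻ x, ENNReal.ofReal (noisyDensity A x) * ENNReal.ofReal (noisyDensity B x) ∂(stdG d) =
      ENNReal.ofReal (noisyChiSq A B) := by
  have hsm : ∀ {M : Matrix (Fin d) (Fin d) ℝ}, M.IsHermitian → ‖M‖ < 1 / 9 →
      (-((9 : ℝ) • M)).IsHermitian ∧ ‖-((9 : ℝ) • M)‖ < 1 := by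
    intro M hM h
    refine ⟨?_, ?_⟩
    · rw [IsHermitian, conjTranspose_neg, conjTranspose_smul, hM.eq]; simp
    · rw [norm_neg, norm_smul, Real.norm_ofNat]; linarith
  have key : ∀ S T : Matrix (Fin d) (Fin d) ℝ, Measurable fun x =>
      ENNReal.ofReal (gaussTilt S x * gaussTilt T x) := fun S T =>
    ENNReal.measurable_ofReal.comp ((measurable_gaussTilt S).mul (measurable_gaussTilt T))
  have n : ∀ S T : Matrix (Fin d) (Fin d) ℝ, ∀ x, 0 ≤ gaussTilt S x * gaussTilt T x :=
    fun S T x => mul_nonneg (gaussTilt_nonneg S x) (gaussTilt_nonneg T x)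
  have e : ∀ x, ENNReal.ofReal (noisyDensity A x) * ENNReal.ofReal (noisyDensity B x) =
      ENNReal.ofReal (81 / 100) * ENNReal.ofReal (gaussTilt (1 + A) x * gaussTilt (1 + B) x) +
      ENNReal.ofReal (9 / 100) *
        ENNReal.ofReal (gaussTilt (1 + A) x * gaussTilt (1 + -((9 : ℝ) • B)) x) +
      ENNReal.ofReal (9 / 100) *
        ENNReal.ofReal (gaussTilt (1 + -((9 : ℝ) • A)) x * gaussTilt (1 + B) x) +
      ENNReal.ofReal (1 / 100) *
        ENNReal.ofReal (gaussTilt (1 + -((9 : ℝ) • A)) x * gaussTilt (1 + -((9 : ℝ) • B)) x) := by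
    intro x
    have n1 := n (1 + A) (1 + B) x
    have n2 := n (1 + A) (1 + -((9 : ℝ) • B)) x
    have n3 := n (1 + -((9 : ℝ) • A)) (1 + B) x
    have n4 := n (1 + -((9 : ℝ) • A)) (1 + -((9 : ℝ) • B)) x
    rw [← ENNReal.ofReal_mul (noisyDensity_nonneg A x), ← ENNReal.ofReal_mul (by norm_num),
      ← ENNReal.ofReal_mul (by norm_num), ← ENNReal.ofReal_mul (by norm_num),
      ← ENNReal.ofReal_mul (by norm_num), ← ENNReal.ofReal_add (by positivity) (by positivity),
      ← ENNReal.ofReal_add (by positivity) (by positivity),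
      ← ENNReal.ofReal_add (by positivity) (by positivity)]
    congr 1
    simp only [noisyDensity, sub_eq_add_neg]
    ring
  obtain ⟨hA9, hA9'⟩ := hsm hA hA1
  obtain ⟨hB9, hB9'⟩ := hsm hB hB1
  have m := fun (c : ℝ≥0∞) S T => (key S T).const_mul c
  simp_rw [e]
  rw [stdG, multivariateGaussian_zero_one, lintegral_add_right _ (m _ _ _),
    lintegral_add_right _ (m _ _ _), lintegral_add_right _ (m _ _ _),
    lintegral_const_mul _ (key _ _), lintegral_const_mul _ (key _ _),
    lintegral_const_mul _ (key _ _), lintegral_const_mul _ (key _ _),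
    lintegral_gaussTilt_mul_gaussTilt hA hB (by linarith) (by linarith),
    lintegral_gaussTilt_mul_gaussTilt hA hB9 (by linarith) hB9',
    lintegral_gaussTilt_mul_gaussTilt hA9 hB hA9' (by linarith),
    lintegral_gaussTilt_mul_gaussTilt hA9 hB9 hA9' hB9',
    ← ENNReal.ofReal_mul (by norm_num),
      ← ENNReal.ofReal_mul (by norm_num), ← ENNReal.ofReal_mul (by norm_num),
      ← ENNReal.ofReal_mul (by norm_num), ← ENNReal.ofReal_add (by positivity) (by positivity),
      ← ENNReal.ofReal_add (by positivity) (by positivity),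
      ← ENNReal.ofReal_add (by positivity) (by positivity)]
  congr 1
  have e2 : A * -((9 : ℝ) • B) = (-9 : ℝ) • (A * B) := by simp
  have e3 : -((9 : ℝ) • A) * B = (-9 : ℝ) • (A * B) := by simp
  have e4 : -((9 : ℝ) • A) * -((9 : ℝ) • B) = (81 : ℝ) • (A * B) := by
    rw [neg_mul_neg, smul_mul_smul_comm]; norm_num
  rw [e2, e3, e4, noisyChiSq]
  ring

instance : IsProbabilityMeasure (entryLaw d) := by unfold entryLaw; infer_instance
instance : IsProbabilityMeasure (stdG d) := by unfold stdG; infer_instance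

instance {E : Type*} [MeasurableSpace E] (N : ℕ) (P : Measure E) [IsProbabilityMeasure P] :
    IsProbabilityMeasure (iidSamples N P) := by unfold iidSamples; infer_instance

theorem isProbabilityMeasure_noisyGaussian (A : Matrix (Fin d) (Fin d) ℝ) :
    IsProbabilityMeasure (noisyGaussian A) := by
  refine ⟨?_⟩
  simp only [noisyGaussian, Measure.add_apply, Measure.smul_apply, measure_univ, smul_eq_mul, mul_one]
  rw [← ENNReal.add_div, show (9 : ℝ≥0∞) + 1 = 10 by norm_num]
  exact ENNReal.div_self (by norm_num) (by norm_num)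

/-- The product density of `N` i.i.d. samples of the noisy Gaussian. -/
noncomputable def samplesDensity (N : ℕ) (g : {p : Fin d × Fin d // p.1 < p.2} → ℝ)
    (x : Fin N → EuclideanSpace ℝ (Fin d)) : ℝ≥0∞ :=
  ∏ i, ENNReal.ofReal (noisyDensity (symMatrix g) (x i))

theorem measurable_samplesDensity (N : ℕ) :
    Measurable (Function.uncurry (samplesDensity (d := d) N)) := by
  unfold samplesDensity
  refine Finset.measurable_prod _ fun i _ => ENNReal.measurable_ofReal.comp ?_
  exact measurable_noisyDensity_symMatrix.comp
    (f := fun p : ({p : Fin d × Fin d // p.1 < p.2} → ℝ) × (Fin N → EuclideanSpace ℝ (Fin d)) =>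
      (p.1, p.2 i)) (by fun_prop)

theorem iidSamples_noisyGaussian_eq_withDensity (N : ℕ)
    {g : {p : Fin d × Fin d // p.1 < p.2} → ℝ} (hg : matSpectralNorm (symMatrix g) < 1 / 9) :
    iidSamples N (noisyGaussian (symMatrix g)) =
      (iidSamples N (stdG d)).withDensity (samplesDensity N g) := by
  have hH := isHermitian_symMatrix g
  have hn : ‖symMatrix g‖ < 1 / 9 := hg
  have h := noisyGaussian_eq_withDensity
    (posDef_one_add_of_l2_opNorm_lt_one hH (by linarith))
    (posDef_one_sub_of_l2_opNorm_lt_one (M := (9 : ℝ) • symMatrix g)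
      (by rw [IsHermitian, conjTranspose_smul, hH.eq]; simp)
      (by rw [norm_smul, Real.norm_ofNat]; linarith))
  have hp := isProbabilityMeasure_noisyGaussian (symMatrix g)
  rw [h] at hp ⊢
  exact Measure.pi_withDensity fun _ =>
    ENNReal.measurable_ofReal.comp (measurable_noisyDensity _)

theorem lintegral_samplesDensity_mul (N : ℕ) {g h : {p : Fin d × Fin d // p.1 < p.2} → ℝ}
    (hg : matSpectralNorm (symMatrix g) < 1 / 9) (hh : matSpectralNorm (symMatrix h) < 1 / 9) :
    ∫⁻ x, samplesDensity N g x * samplesDensity N h x ∂(iidSamples N (stdG d)) =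
      ENNReal.ofReal (noisyChiSq (symMatrix g) (symMatrix h)) ^ N := by
  simp_rw [samplesDensity, ← Finset.prod_mul_distrib]
  rw [iidSamples, lintegral_fintype_prod_eq_prod (f := fun _ x =>
      ENNReal.ofReal (noisyDensity (symMatrix g) x) * ENNReal.ofReal (noisyDensity (symMatrix h) x))
    fun _ => ?_]
  · rw [lintegral_noisyDensity_mul (isHermitian_symMatrix g) (isHermitian_symMatrix h) hg hh]
    simp
  · exact (ENNReal.measurable_ofReal.comp (measurable_noisyDensity _)).mul
      (ENNReal.measurable_ofReal.comp (measurable_noisyDensity _))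

/-- The chi-squared of the ensemble as an average over two independent conditioned matrices,
together with its Cauchy-Schwarz lower bound. -/
theorem chiSq_ensembleSamples {C₁ C₂ : ℝ} (hC : C₁ / √(d : ℝ) < 1 / 9)
    (hE : entryLaw d (normEvent d C₁ C₂) ≠ 0) (N : ℕ) :
    chiSq (iidSamples N (stdG d)) (ensembleSamples d C₁ C₂ N) (ensembleSamples d C₁ C₂ N) =
      ∫⁻ g, ∫⁻ h, ENNReal.ofReal (noisyChiSq (symMatrix g) (symMatrix h)) ^ N
        ∂(entryLaw d)[|normEvent d C₁ C₂] ∂(entryLaw d)[|normEvent d C₁ C₂] ∧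
    1 ≤ chiSq (iidSamples N (stdG d)) (ensembleSamples d C₁ C₂ N) (ensembleSamples d C₁ C₂ N) := by
  set ν := (entryLaw d)[|normEvent d C₁ C₂] with hν
  have : IsProbabilityMeasure ν := cond_isProbabilityMeasure hE
  have hmem : ∀ᵐ g ∂ν, matSpectralNorm (symMatrix g) < 1 / 9 := by
    -- The threshold $1/9$ makes $I+A$ and $I-9A$ both positive definite, with the perturbation of
    -- norm below 1 in each.
    filter_upwards [ae_cond_mem (measurableSet_normEvent C₁ C₂)] with g hg
    exact hg.1.trans_lt hC
  have hmF := measurable_samplesDensity (d := d) N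
  have hbind : ensembleSamples d C₁ C₂ N = (iidSamples N (stdG d)).withDensity
      fun x => ∫⁻ g, samplesDensity N g x ∂ν := by
    refine bind_eq_withDensity hmF ?_
    filter_upwards [hmem] with g hg using iidSamples_noisyGaussian_eq_withDensity N hg
  have hmh : Measurable fun x => ∫⁻ g, samplesDensity (d := d) N g x ∂ν :=
    Measurable.lintegral_prod_left hmF
  have hmass : ∫⁻ x, ∫⁻ g, samplesDensity (d := d) N g x ∂ν ∂(iidSamples N (stdG d)) = 1 := by
    rw [lintegral_lintegral_swap (f := fun x g => samplesDensity N g x)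
      (hmF.comp measurable_swap).aemeasurable]
    have : ∀ᵐ g ∂ν, ∫⁻ x, samplesDensity N g x ∂(iidSamples N (stdG d)) = 1 := by
      filter_upwards [hmem] with g hg
      have hp := isProbabilityMeasure_noisyGaussian (symMatrix g)
      have h1 : iidSamples N (noisyGaussian (symMatrix g)) Set.univ = 1 := measure_univ
      rwa [iidSamples_noisyGaussian_eq_withDensity N hg, withDensity_apply _ MeasurableSet.univ,
        setLIntegral_univ] at h1
    rw [lintegral_congr_ae this]
    simp
  have hfin : IsFiniteMeasure ((iidSamples N (stdG d)).withDensity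
      fun x => ∫⁻ g, samplesDensity N g x ∂ν) :=
    isFiniteMeasure_withDensity (by rw [hmass]; exact ENNReal.one_ne_top)
  rw [hbind, chiSq_withDensity hmh]
  refine ⟨?_, one_le_lintegral_mul_self hmh hmass⟩
  rw [lintegral_mixture_sq hmF]
  refine lintegral_congr_ae ?_
  filter_upwards [hmem] with g hg
  refine lintegral_congr_ae ?_
  filter_upwards [hmem] with h hh using lintegral_samplesDensity_mul N hg hh

end RobustCov

/-! ### Traces as quadratic forms in the entries above the diagonal -/

theorem Fintype.sum_dite_eq_sum_subtype {α M : Type*} [Fintype α] [AddCommMonoid M] {P : α → Prop}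
    [DecidablePred P] (G : {a // P a} → M) :
    ∑ a, (if h : P a then G ⟨a, h⟩ else 0) = ∑ p : {a // P a}, G p := by
  rw [Finset.sum_dite, Finset.sum_const_zero, add_zero]
  refine Finset.sum_bij' (fun a _ => ⟨a.1, (Finset.mem_filter.1 a.2).2⟩)
    (fun p _ => ⟨p.1, Finset.mem_filter.2 ⟨Finset.mem_univ _, p.2⟩⟩) ?_ ?_ ?_ ?_ ?_ <;> simp

namespace RobustCov
open Matrix

variable {d : ℕ}

/-- The index type of the entries above the diagonal. -/
abbrev UpperPairs (d : ℕ) : Type := {p : Fin d × Fin d // p.1 < p.2}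

theorem sum_symMatrix_mul (g : UpperPairs d → ℝ) (h : Fin d → Fin d → ℝ) :
    ∑ i, ∑ j, symMatrix g i j * h i j = ∑ p : UpperPairs d, g p * (h p.1.1 p.1.2 + h p.1.2 p.1.1) := by
  have e : ∀ i j, symMatrix g i j * h i j =
      (if hij : i < j then g ⟨(i, j), hij⟩ * h i j else 0) +
      (if hij : j < i then g ⟨(j, i), hij⟩ * h i j else 0) := by
    intro i j
    simp only [symMatrix, Matrix.of_apply]
    rcases lt_trichotomy i j with hij | hij | hij
    · simp [hij, hij.not_gt]
    · subst hij; simp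
    · simp [hij, hij.not_gt]
  simp_rw [e, Finset.sum_add_distrib, mul_add, Finset.sum_add_distrib]
  congr 1
  · rw [← Fintype.sum_prod_type' (f := fun i j => if hij : i < j then g ⟨(i, j), hij⟩ * h i j else 0)]
    exact Fintype.sum_dite_eq_sum_subtype (P := fun q : Fin d × Fin d => q.1 < q.2)
      (fun p => g p * h p.1.1 p.1.2)
  · rw [Finset.sum_comm,
      ← Fintype.sum_prod_type' (f := fun i j => if hij : i < j then g ⟨(i, j), hij⟩ * h j i else 0)]
    exact Fintype.sum_dite_eq_sum_subtype (P := fun q : Fin d × Fin d => q.1 < q.2)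
      (fun p => g p * h p.1.2 p.1.1)

theorem sum_upperPairs_le {f : Fin d → Fin d → ℝ} (hf : ∀ i j, 0 ≤ f i j) :
    ∑ p : UpperPairs d, f p.1.1 p.1.2 ≤ ∑ i, ∑ j, f i j := by
  rw [← Fintype.sum_dite_eq_sum_subtype (P := fun q : Fin d × Fin d => q.1 < q.2)
    (fun p => f p.1.1 p.1.2), ← Fintype.sum_prod_type' (f := f)]
  refine Finset.sum_le_sum fun q _ => ?_
  split_ifs
  · exact le_rfl
  · exact hf _ _

theorem symMatrix_apply_comm (g : UpperPairs d → ℝ) (i j : Fin d) :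
    symMatrix g i j = symMatrix g j i := by
  have := (isHermitian_symMatrix g).apply j i
  simpa using this

theorem trace_symMatrix_mul (g h : UpperPairs d → ℝ) :
    (symMatrix g * symMatrix h).trace =
      2 * ∑ p : UpperPairs d, g p * symMatrix h p.1.1 p.1.2 := by
  have e : (symMatrix g * symMatrix h).trace = ∑ i, ∑ j, symMatrix g i j * symMatrix h i j := by
    simp only [trace, diag, mul_apply]
    exact Finset.sum_congr rfl fun i _ => Finset.sum_congr rfl fun j _ => by
      rw [symMatrix_apply_comm h j i]
  rw [e, sum_symMatrix_mul g fun i j => symMatrix h i j, Finset.mul_sum]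
  refine Finset.sum_congr rfl fun p _ => ?_
  rw [symMatrix_apply_comm h p.1.2 p.1.1]; ring

theorem trace_symMatrix_mul_sq (g h : UpperPairs d → ℝ) :
    (symMatrix g * symMatrix h * (symMatrix g * symMatrix h)).trace =
      2 * ∑ p : UpperPairs d, g p * ∑ q : UpperPairs d,
        (symMatrix h p.1.1 q.1.1 * symMatrix h p.1.2 q.1.2 +
          symMatrix h p.1.1 q.1.2 * symMatrix h p.1.2 q.1.1) * g q := by
  set B := symMatrix h with hB
  have hBs : ∀ i j, B i j = B j i := symMatrix_apply_comm h
  have e1 : (symMatrix g * B * (symMatrix g * B)).trace =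
      ∑ i, ∑ j, symMatrix g i j * (B * symMatrix g * B) j i := by
    rw [Matrix.mul_assoc, ← Matrix.mul_assoc B]
    simp only [trace, diag, mul_apply (M := symMatrix g)]
  have e2 : ∀ i j, (B * symMatrix g * B) i j =
      ∑ q : UpperPairs d, (B i q.1.1 * B j q.1.2 + B i q.1.2 * B j q.1.1) * g q := by
    intro i j
    have : (B * symMatrix g * B) i j = ∑ k, ∑ l, symMatrix g k l * (B i k * B j l) := by
      simp only [mul_apply, Finset.sum_mul]
      rw [Finset.sum_comm]
      refine Finset.sum_congr rfl fun k _ => Finset.sum_congr rfl fun l _ => ?_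
      rw [hBs l j]; ring
    rw [this, sum_symMatrix_mul]
    exact Finset.sum_congr rfl fun q _ => by ring
  rw [e1, sum_symMatrix_mul g (fun i j => (B * symMatrix g * B) j i), Finset.mul_sum]
  refine Finset.sum_congr rfl fun p _ => ?_
  rw [e2, e2, ← Finset.sum_add_distrib, Finset.mul_sum, Finset.mul_sum, Finset.mul_sum]
  exact Finset.sum_congr rfl fun q _ => by ring

theorem entryLaw_eq_map (d : ℕ) : entryLaw d =
    (stdGaussian (EuclideanSpace ℝ (UpperPairs d))).map fun x p => (d : ℝ)⁻¹ * x p := by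
  have h : gaussianReal 0 (1 / (d : ℝ≥0) ^ 2) =
      (gaussianReal 0 1).map (fun x => (d : ℝ)⁻¹ * x) := by
    rw [gaussianReal_map_const_mul, mul_zero]
    congr 1
    ext
    simp
  rw [← map_pi_eq_stdGaussian, Measure.map_map (by fun_prop) (by fun_prop), entryLaw]
  rw [h, ← Measure.pi_map_pi (fun _ => by fun_prop)]
  rfl

theorem lintegral_entryLaw {f : (UpperPairs d → ℝ) → ℝ≥0∞} (hf : Measurable f) :
    ∫⁻ g, f g ∂(entryLaw d) = ∫⁻ x, f (fun p => (d : ℝ)⁻¹ * x p)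
      ∂(stdGaussian (EuclideanSpace ℝ (UpperPairs d))) := by
  rw [entryLaw_eq_map, lintegral_map hf (by fun_prop)]

theorem symMatrix_diag (g : UpperPairs d → ℝ) (i : Fin d) : symMatrix g i i = 0 := by
  simp [symMatrix]

/-- The matrix of the quadratic form `A ↦ L tr(AB)² + (81/4) tr(ABAB)`, with `B = symMatrix h`,
in the entries of `A` above the diagonal. -/
noncomputable def traceForm (L : ℝ) (h : UpperPairs d → ℝ) :
    Matrix (UpperPairs d) (UpperPairs d) ℝ :=
  Matrix.of fun p q => 4 * L * (symMatrix h p.1.1 p.1.2 * symMatrix h q.1.1 q.1.2) +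
    81 / 2 * (symMatrix h p.1.1 q.1.1 * symMatrix h p.1.2 q.1.2 +
      symMatrix h p.1.1 q.1.2 * symMatrix h p.1.2 q.1.1)

theorem isHermitian_traceForm (L : ℝ) (h : UpperPairs d → ℝ) : (traceForm L h).IsHermitian := by
  ext p q
  simp only [traceForm, conjTranspose_apply, Matrix.of_apply, star_trivial]
  rw [symMatrix_apply_comm h q.1.1 p.1.1, symMatrix_apply_comm h q.1.2 p.1.2,
    symMatrix_apply_comm h q.1.1 p.1.2, symMatrix_apply_comm h q.1.2 p.1.1]
  ring

theorem dotProduct_traceForm_mulVec (L : ℝ) (g h : UpperPairs d → ℝ) :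
    g ⬝ᵥ traceForm L h *ᵥ g = L * (symMatrix g * symMatrix h).trace ^ 2 +
      81 / 4 * (symMatrix g * symMatrix h * (symMatrix g * symMatrix h)).trace := by
  rw [trace_symMatrix_mul, trace_symMatrix_mul_sq]
  simp only [dotProduct, mulVec, traceForm, Matrix.of_apply]
  have e : L * (2 * ∑ p : UpperPairs d, g p * symMatrix h p.1.1 p.1.2) ^ 2 =
      ∑ p : UpperPairs d, g p * ∑ q : UpperPairs d,
        4 * L * (symMatrix h p.1.1 p.1.2 * symMatrix h q.1.1 q.1.2) * g q := by
    rw [mul_pow, pow_two (∑ p : UpperPairs d, g p * symMatrix h p.1.1 p.1.2), Finset.sum_mul_sum,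
      Finset.mul_sum, Finset.mul_sum]
    refine Finset.sum_congr rfl fun p _ => ?_
    rw [Finset.mul_sum, Finset.mul_sum, Finset.mul_sum]
    exact Finset.sum_congr rfl fun q _ => by ring
  rw [e, Finset.mul_sum, Finset.mul_sum, ← Finset.sum_add_distrib]
  refine Finset.sum_congr rfl fun p _ => ?_
  rw [Finset.mul_sum, Finset.mul_sum, Finset.mul_sum, Finset.mul_sum, Finset.mul_sum,
    ← Finset.sum_add_distrib]
  exact Finset.sum_congr rfl fun q _ => by ring

/-- On the diagonal $p=q=(i,j)$ the product $B_{ii}B_{jj}$ vanishes, so each entry is a multiple of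
$B_{ij}^2$. -/
theorem trace_traceForm_le {L : ℝ} (hL : 0 ≤ L) (h : UpperPairs d → ℝ) :
    (traceForm L h).trace ≤ (4 * L + 81 / 2) * ∑ i, ∑ j, symMatrix h i j ^ 2 := by
  have h1 := sum_upperPairs_le (f := fun i j => symMatrix h i j ^ 2) fun i j => sq_nonneg _
  calc (traceForm L h).trace = (4 * L + 81 / 2) *
        ∑ p : UpperPairs d, symMatrix h p.1.1 p.1.2 ^ 2 := by
        rw [Finset.mul_sum]
        simp only [trace, diag, traceForm, Matrix.of_apply]
        refine Finset.sum_congr rfl fun p _ => ?_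
        rw [symMatrix_diag, symMatrix_apply_comm h p.1.2 p.1.1]
        ring
    _ ≤ _ := by gcongr

/-- After $(a+b+c)^2\le3(a^2+b^2+c^2)$, the sum is extended from pairs above the diagonal to all
indices, where each of the three quadruple sums factors as $\|B\|_F^4$. Here $48=3\cdot16$ and
$4921\ge3(81/2)^2$. -/
theorem sum_sq_traceForm_le (L : ℝ) (h : UpperPairs d → ℝ) :
    ∑ p, ∑ q, traceForm L h p q ^ 2 ≤
      (48 * L ^ 2 + 9842) * (∑ i, ∑ j, symMatrix h i j ^ 2) ^ 2 := by
  set B := symMatrix h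
  have h1 : ∀ p q, traceForm L h p q ^ 2 ≤ 48 * L ^ 2 * (B p.1.1 p.1.2 ^ 2 * B q.1.1 q.1.2 ^ 2) +
      4921 * (B p.1.1 q.1.1 ^ 2 * B p.1.2 q.1.2 ^ 2) +
      4921 * (B p.1.1 q.1.2 ^ 2 * B p.1.2 q.1.1 ^ 2) := by
    intro p q
    simp only [traceForm, Matrix.of_apply]
    have key : ∀ a b c : ℝ, (4 * L * a + 81 / 2 * (b + c)) ^ 2 ≤
        48 * L ^ 2 * a ^ 2 + 4921 * b ^ 2 + 4921 * c ^ 2 := by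
      intro a b c
      nlinarith [sq_nonneg (4 * L * a - 81 / 2 * b), sq_nonneg (4 * L * a - 81 / 2 * c),
        sq_nonneg (b - c), sq_nonneg b, sq_nonneg c]
    refine (key _ _ _).trans_eq ?_
    ring
  have hnn : ∀ i j k l, 0 ≤ 48 * L ^ 2 * (B i j ^ 2 * B k l ^ 2) +
      4921 * (B i k ^ 2 * B j l ^ 2) + 4921 * (B i l ^ 2 * B j k ^ 2) := fun i j k l => by positivity
  calc ∑ p, ∑ q, traceForm L h p q ^ 2
      ≤ ∑ p : UpperPairs d, ∑ q : UpperPairs d,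
          (48 * L ^ 2 * (B p.1.1 p.1.2 ^ 2 * B q.1.1 q.1.2 ^ 2) +
            4921 * (B p.1.1 q.1.1 ^ 2 * B p.1.2 q.1.2 ^ 2) +
            4921 * (B p.1.1 q.1.2 ^ 2 * B p.1.2 q.1.1 ^ 2)) :=
        Finset.sum_le_sum fun p _ => Finset.sum_le_sum fun q _ => h1 p q
    _ ≤ ∑ i, ∑ j, ∑ k, ∑ l, (48 * L ^ 2 * (B i j ^ 2 * B k l ^ 2) +
          4921 * (B i k ^ 2 * B j l ^ 2) + 4921 * (B i l ^ 2 * B j k ^ 2)) := by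
        refine le_trans (Finset.sum_le_sum fun p _ => sum_upperPairs_le
          (f := fun k l => 48 * L ^ 2 * (B p.1.1 p.1.2 ^ 2 * B k l ^ 2) +
            4921 * (B p.1.1 k ^ 2 * B p.1.2 l ^ 2) + 4921 * (B p.1.1 l ^ 2 * B p.1.2 k ^ 2))
          fun k l => hnn _ _ _ _) ?_
        exact sum_upperPairs_le (f := fun i j => ∑ k, ∑ l, (48 * L ^ 2 * (B i j ^ 2 * B k l ^ 2) +
          4921 * (B i k ^ 2 * B j l ^ 2) + 4921 * (B i l ^ 2 * B j k ^ 2)))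
          fun i j => Finset.sum_nonneg fun k _ => Finset.sum_nonneg fun l _ => hnn _ _ _ _
    _ = (48 * L ^ 2 + 9842) * (∑ i, ∑ j, B i j ^ 2) ^ 2 := by
        have s1 : ∑ i, ∑ j, ∑ k, ∑ l, B i j ^ 2 * B k l ^ 2 = (∑ i, ∑ j, B i j ^ 2) ^ 2 := by
          simp only [← Finset.mul_sum, ← Finset.sum_mul, pow_two (∑ i, ∑ j, B i j ^ 2)]
        have s2 : ∑ i, ∑ j, ∑ k, ∑ l, B i k ^ 2 * B j l ^ 2 = (∑ i, ∑ j, B i j ^ 2) ^ 2 := by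
          simp only [← Finset.mul_sum, ← Finset.sum_mul, pow_two (∑ i, ∑ j, B i j ^ 2)]
        have s3 : ∑ i, ∑ j, ∑ k, ∑ l, B i l ^ 2 * B j k ^ 2 = (∑ i, ∑ j, B i j ^ 2) ^ 2 := by
          rw [← s2]
          refine Finset.sum_congr rfl fun i _ => Finset.sum_congr rfl fun j _ => ?_
          exact Finset.sum_comm
        simp only [Finset.sum_add_distrib, ← Finset.mul_sum] at s1 s2 s3 ⊢
        rw [s1, s2, s3]
        ring

/-- The exponential moment of `ε d² (L tr(AB)² + (81/4) tr(ABAB))` over the random matrix `A`. -/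
theorem lintegral_entryLaw_exp_traceForm_le {L ε F : ℝ} (hL : 0 ≤ L) (hε : 0 ≤ ε) (hd : d ≠ 0)
    (h : UpperPairs d → ℝ) (hF : ∑ i, ∑ j, symMatrix h i j ^ 2 ≤ F)
    (hsmall : ε ^ 2 * ((48 * L ^ 2 + 9842) * F ^ 2) ≤ 1 / 16) :
    ∫⁻ g, ENNReal.ofReal (Real.exp (ε * d ^ 2 * (L * (symMatrix g * symMatrix h).trace ^ 2 +
      81 / 4 * (symMatrix g * symMatrix h * (symMatrix g * symMatrix h)).trace))) ∂(entryLaw d) ≤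
    ENNReal.ofReal (Real.exp (ε * ((4 * L + 81 / 2) * F) +
      4 * (ε ^ 2 * ((48 * L ^ 2 + 9842) * F ^ 2)))) := by
  simp_rw [← dotProduct_traceForm_mulVec]
  have hF0 : 0 ≤ ∑ i, ∑ j, symMatrix h i j ^ 2 := by positivity
  rw [lintegral_entryLaw (by
    refine ENNReal.measurable_ofReal.comp (Real.measurable_exp.comp (Measurable.const_mul ?_ _))
    simp only [dotProduct, mulVec]
    fun_prop)]
  -- The factor $d^2$ from the number of samples cancels the entry variance $1/d^2$.
  have e : ∀ x : EuclideanSpace ℝ (UpperPairs d),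
      ε * d ^ 2 * ((fun p => (d : ℝ)⁻¹ * x p) ⬝ᵥ traceForm L h *ᵥ fun p => (d : ℝ)⁻¹ * x p) =
      x.ofLp ⬝ᵥ (ε • traceForm L h) *ᵥ x.ofLp := by
    intro x
    have : (fun p => (d : ℝ)⁻¹ * x p) = (d : ℝ)⁻¹ • x.ofLp := rfl
    have hd' : (d : ℝ) ≠ 0 := by exact_mod_cast hd
    rw [this, mulVec_smul, smul_dotProduct, dotProduct_smul, smul_mulVec, dotProduct_smul]
    simp only [smul_eq_mul]
    field_simp
  simp_rw [e]
  have hs : ∑ p, ∑ q, (ε • traceForm L h) p q ^ 2 ≤ ε ^ 2 * ((48 * L ^ 2 + 9842) * F ^ 2) := by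
    simp only [Matrix.smul_apply, smul_eq_mul, mul_pow, ← Finset.mul_sum]
    gcongr
    exact (sum_sq_traceForm_le L h).trans (by gcongr)
  have hH : (ε • traceForm L h).IsHermitian := by
    rw [IsHermitian, conjTranspose_smul, (isHermitian_traceForm L h).eq]; simp
  refine (lintegral_exp_quadraticForm_le hH (hs.trans hsmall)).trans ?_
  refine ENNReal.ofReal_le_ofReal (Real.exp_le_exp.2 ?_)
  rw [trace_smul, smul_eq_mul]
  gcongr
  exact (trace_traceForm_le hL h).trans (by gcongr)

end RobustCov

/-! ### Tail bound for the spectral norm -/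

namespace RobustCov
open Matrix

variable {d : ℕ}

theorem lintegral_exp_mul_gaussianReal (v : ℝ≥0) (c : ℝ) :
    ∫⁻ x, ENNReal.ofReal (Real.exp (c * x)) ∂(gaussianReal 0 v) =
      ENNReal.ofReal (Real.exp (v * c ^ 2 / 2)) := by
  rw [← ofReal_integral_eq_lintegral_ofReal (integrable_exp_mul_gaussianReal c)
    (ae_of_all _ fun _ => (Real.exp_pos _).le)]
  have := congrFun (mgf_fun_id_gaussianReal (μ := 0) (v := v)) c
  rw [mgf, zero_mul, zero_add] at this
  rw [this]

theorem lintegral_entryLaw_exp_linear (c : UpperPairs d → ℝ) :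
    ∫⁻ g, ENNReal.ofReal (Real.exp (∑ p, c p * g p)) ∂(entryLaw d) =
      ENNReal.ofReal (Real.exp ((∑ p, c p ^ 2) / (2 * d ^ 2))) := by
  simp_rw [Real.exp_sum, ENNReal.ofReal_prod_of_nonneg fun _ _ => (Real.exp_pos _).le]
  rw [entryLaw, lintegral_fintype_prod_eq_prod
    (f := fun p x => ENNReal.ofReal (Real.exp (c p * x))) fun _ => by fun_prop]
  simp_rw [lintegral_exp_mul_gaussianReal]
  rw [← ENNReal.ofReal_prod_of_nonneg fun _ _ => (Real.exp_pos _).le, ← Real.exp_sum,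
    Finset.sum_div]
  congr 2
  refine Finset.sum_congr rfl fun p _ => ?_
  push_cast
  rw [mul_comm (2 : ℝ), ← div_div]
  ring

theorem dotProduct_symMatrix_mulVec (g : UpperPairs d → ℝ) (v : Fin d → ℝ) :
    v ⬝ᵥ symMatrix g *ᵥ v = ∑ p : UpperPairs d, 2 * (v p.1.1 * v p.1.2) * g p := by
  have : v ⬝ᵥ symMatrix g *ᵥ v = ∑ i, ∑ j, symMatrix g i j * (v i * v j) := by
    simp only [dotProduct, mulVec, Finset.mul_sum]
    exact Finset.sum_congr rfl fun i _ => Finset.sum_congr rfl fun j _ => by ring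
  rw [this, sum_symMatrix_mul g fun i j => v i * v j]
  exact Finset.sum_congr rfl fun p _ => by ring

theorem lintegral_entryLaw_exp_dotProduct_le (t : ℝ) (v : EuclideanSpace ℝ (Fin d)) :
    ∫⁻ g, ENNReal.ofReal (Real.exp (t * (v.ofLp ⬝ᵥ symMatrix g *ᵥ v.ofLp))) ∂(entryLaw d) ≤
      ENNReal.ofReal (Real.exp (2 * t ^ 2 * ‖v‖ ^ 4 / d ^ 2)) := by
  have e : ∀ g : UpperPairs d → ℝ, t * (v.ofLp ⬝ᵥ symMatrix g *ᵥ v.ofLp) =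
      ∑ p : UpperPairs d, 2 * t * (v p.1.1 * v p.1.2) * g p := by
    intro g
    rw [dotProduct_symMatrix_mulVec, Finset.mul_sum]
    exact Finset.sum_congr rfl fun p _ => by ring
  simp_rw [e]
  rw [lintegral_entryLaw_exp_linear]
  refine ENNReal.ofReal_le_ofReal (Real.exp_le_exp.2 ?_)
  have h1 := sum_upperPairs_le (d := d) (f := fun i j => (2 * t * (v i * v j)) ^ 2)
    fun i j => sq_nonneg _
  have h2 : ∑ i, ∑ j, (2 * t * (v i * v j)) ^ 2 = 4 * t ^ 2 * ‖v‖ ^ 4 := by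
    have h3 : ‖v‖ ^ 4 = (∑ i, v i ^ 2) * ∑ j, v j ^ 2 := by
      rw [← EuclideanSpace.real_norm_sq_eq]; ring
    rw [h3, Finset.sum_mul_sum, Finset.mul_sum]
    refine Finset.sum_congr rfl fun i _ => ?_
    rw [Finset.mul_sum]
    exact Finset.sum_congr rfl fun j _ => by ring
  rw [h2] at h1
  calc (∑ p : UpperPairs d, (2 * t * (v p.1.1 * v p.1.2)) ^ 2) / (2 * d ^ 2)
      ≤ 4 * t ^ 2 * ‖v‖ ^ 4 / (2 * d ^ 2) := by gcongr
    _ = _ := by rw [← div_div]; ring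

/-- For a symmetric operator the norm is the supremum of $|$Rayleigh quotient$|$; the factor
$\frac12$ avoids having to attain it. -/
theorem exists_unit_lt_abs_dotProduct {A : Matrix (Fin d) (Fin d) ℝ} (hA : A.IsHermitian)
    (h : 0 < matSpectralNorm A) : ∃ u : EuclideanSpace ℝ (Fin d), ‖u‖ = 1 ∧
      matSpectralNorm A / 2 < |u.ofLp ⬝ᵥ A *ᵥ u.ofLp| := by
  set T := toEuclideanCLM (n := Fin d) (𝕜 := ℝ) A with hT
  have hTs : (T : EuclideanSpace ℝ (Fin d) →ₗ[ℝ] _).IsSymmetric := by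
    have : IsSelfAdjoint T := IsSelfAdjoint.map (x := A) hA _
    exact this.isSymmetric
  have hn : matSpectralNorm A = ‖T‖ := rfl
  have hlt : ‖T‖ / 2 < ⨆ x, |T.rayleighQuotient x| := by
    rw [← T.norm_eq_iSup_rayleighQuotient hTs]; rw [hn] at h; linarith
  obtain ⟨x, hx⟩ := exists_lt_of_lt_ciSup hlt
  have hx0 : x ≠ 0 := by
    rintro rfl
    rw [T.rayleighQuotient_apply_zero, abs_zero] at hx
    rw [hn] at h; linarith
  have hnx : 0 < ‖x‖ := norm_pos_iff.2 hx0
  refine ⟨‖x‖⁻¹ • x, ?_, ?_⟩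
  · rw [norm_smul, norm_inv, norm_norm, inv_mul_cancel₀ hnx.ne']
  · rw [← T.rayleigh_smul x (c := ‖x‖⁻¹) (by positivity)] at hx
    set u := ‖x‖⁻¹ • x with hu
    have hu1 : ‖u‖ = 1 := by rw [hu, norm_smul, norm_inv, norm_norm, inv_mul_cancel₀ hnx.ne']
    have e : u.ofLp ⬝ᵥ A *ᵥ u.ofLp = T.rayleighQuotient u := by
      rw [ContinuousLinearMap.rayleighQuotient.eq_def, hu1, one_pow, div_one,
        ContinuousLinearMap.reApplyInnerSelf_apply, real_inner_comm, hT, inner_toEuclideanCLM]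
      rfl
    rw [hn, e]
    exact hx

/-- Moving from $u$ to $v$ changes the form by at most
$(\frac18\cdot\frac98+\frac18)\|A\|=\frac{17}{64}\|A\|$, and $\frac12-\frac{17}{64}=\frac{15}{64}$.
-/
theorem le_abs_dotProduct_of_dist_le {A : Matrix (Fin d) (Fin d) ℝ}
    {u v : EuclideanSpace ℝ (Fin d)} (hu : ‖u‖ = 1) (hv : ‖v - u‖ ≤ 1 / 8)
    (h : matSpectralNorm A / 2 < |u.ofLp ⬝ᵥ A *ᵥ u.ofLp|) :
    15 / 64 * matSpectralNorm A ≤ |v.ofLp ⬝ᵥ A *ᵥ v.ofLp| := by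
  set T := toEuclideanCLM (n := Fin d) (𝕜 := ℝ) A with hT
  have hn : matSpectralNorm A = ‖T‖ := rfl
  rw [← inner_toEuclideanCLM] at h ⊢
  rw [hn] at h ⊢
  rw [← hT] at h ⊢
  have hvn : ‖v‖ ≤ 9 / 8 := by
    calc ‖v‖ = ‖(v - u) + u‖ := by rw [sub_add_cancel]
      _ ≤ 9 / 8 := (norm_add_le _ _).trans (by linarith)
  have e : inner ℝ v (T v) - inner ℝ u (T u) = inner ℝ (v - u) (T v) + inner ℝ u (T (v - u)) := by
    rw [map_sub, inner_sub_left, inner_sub_right]; ring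
  have b1 : |inner ℝ (v - u) (T v)| ≤ 1 / 8 * (‖T‖ * (9 / 8)) :=
    (abs_real_inner_le_norm _ _).trans
      (mul_le_mul hv ((T.le_opNorm v).trans (by gcongr)) (norm_nonneg _) (by norm_num))
  have b2 : |inner ℝ u (T (v - u))| ≤ 1 * (‖T‖ * (1 / 8)) :=
    (abs_real_inner_le_norm _ _).trans
      (mul_le_mul hu.le ((T.le_opNorm _).trans (by gcongr)) (norm_nonneg _) (by norm_num))
  have b3 := abs_sub_abs_le_abs_sub (inner ℝ u (T u)) (inner ℝ v (T v))
  rw [abs_sub_comm, e] at b3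
  have b4 := abs_add_le (inner ℝ (v - u) (T v)) (inner ℝ u (T (v - u)))
  linarith

theorem measurable_dotProduct_symMatrix : Measurable
    fun q : (UpperPairs d → ℝ) × EuclideanSpace ℝ (Fin d) =>
      q.2.ofLp ⬝ᵥ symMatrix q.1 *ᵥ q.2.ofLp := by
  simp_rw [dotProduct_symMatrix_mulVec]
  fun_prop

/-- A large norm makes $|v^{\mathsf T}Av|$ large on a whole ball of radius $\frac18$ around a
near-maximiser, hence makes the integral of $e^{tv^{\mathsf T}Av}+e^{-tv^{\mathsf T}Av}$ over the
ball of radius $\frac98$ large. Markov's inequality for this integral loses only the volume ratio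
$9^d$. -/
theorem entryLaw_spectralNorm_gt_le (hd : d ≠ 0) {C : ℝ} (hC : 64 ≤ C) :
    entryLaw d {g | C / √(d : ℝ) < matSpectralNorm (symMatrix g)} ≤
      ENNReal.ofReal (2 * Real.exp (-(8 * d))) := by
  have hdp : (0 : ℝ) < d := by positivity
  -- With this scale both exponents are linear in $d$: at least
  -- $t\cdot\frac{15}{64}\cdot\frac{64}{\sqrt d}=15d$ on the bad event, at most $2(9/8)^4d\le4d$ on
  -- average.
  set t : ℝ := d * √d with ht
  have ht0 : 0 ≤ t := by positivity
  have ht2 : t ^ 2 = d ^ 3 := by rw [ht, mul_pow, Real.sq_sqrt hdp.le]; ring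
  set q : (UpperPairs d → ℝ) → EuclideanSpace ℝ (Fin d) → ℝ := fun g v =>
    v.ofLp ⬝ᵥ symMatrix g *ᵥ v.ofLp with hq
  have hqm : Measurable (Function.uncurry q) := measurable_dotProduct_symMatrix
  set G : (UpperPairs d → ℝ) → EuclideanSpace ℝ (Fin d) → ℝ≥0∞ := fun g v =>
    ENNReal.ofReal (Real.exp (t * q g v)) + ENNReal.ofReal (Real.exp (-t * q g v)) with hG
  have hGm : Measurable (Function.uncurry G) := by
    have h : ∀ s : ℝ, Measurable fun p : (UpperPairs d → ℝ) × EuclideanSpace ℝ (Fin d) =>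
        ENNReal.ofReal (Real.exp (s * q p.1 p.2)) := fun s =>
      ENNReal.measurable_ofReal.comp (Real.measurable_exp.comp (hqm.const_mul s))
    exact (h t).add (h (-t))
  set S := Metric.ball (0 : EuclideanSpace ℝ (Fin d)) (9 / 8) with hS
  set V := (volume : Measure (EuclideanSpace ℝ (Fin d))) (Metric.ball 0 1) with hV
  have hV0 : V ≠ 0 := (Metric.measure_ball_pos volume _ one_pos).ne'
  have hVt : V ≠ ∞ := measure_ball_lt_top.ne
  have hvol : ∀ (u : EuclideanSpace ℝ (Fin d)) {r : ℝ}, 0 < r →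
      volume (Metric.ball u r) = ENNReal.ofReal (r ^ d) * V := by
    intro u r hr
    rw [Measure.addHaar_ball_of_pos _ _ hr, finrank_euclideanSpace_fin]
  have hlow : ∀ g ∈ {g : UpperPairs d → ℝ | C / √(d : ℝ) < matSpectralNorm (symMatrix g)},
      ENNReal.ofReal (Real.exp (15 * d)) * (ENNReal.ofReal ((1 / 8) ^ d) * V) ≤
        ∫⁻ v in S, G g v := by
    intro g hg
    have hg' : C / √(d : ℝ) < matSpectralNorm (symMatrix g) := hg
    have hpos : 0 < matSpectralNorm (symMatrix g) :=
      lt_of_le_of_lt (by positivity) hg'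
    obtain ⟨u, hu, hlt⟩ := exists_unit_lt_abs_dotProduct (isHermitian_symMatrix g) hpos
    have hsub : Metric.ball u (1 / 8) ⊆ S := by
      intro v hv
      rw [Metric.mem_ball, dist_eq_norm] at hv
      rw [hS, Metric.mem_ball, dist_zero_right]
      calc ‖v‖ = ‖(v - u) + u‖ := by rw [sub_add_cancel]
        _ < 9 / 8 := (norm_add_le _ _).trans_lt (by linarith)
    calc ENNReal.ofReal (Real.exp (15 * d)) * (ENNReal.ofReal ((1 / 8) ^ d) * V)
        = ∫⁻ _ in Metric.ball u (1 / 8), ENNReal.ofReal (Real.exp (15 * d)) := by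
          rw [setLIntegral_const, hvol u (by norm_num)]
      _ ≤ ∫⁻ v in Metric.ball u (1 / 8), G g v := by
          refine setLIntegral_mono' measurableSet_ball fun v hv => ?_
          rw [Metric.mem_ball, dist_eq_norm] at hv
          have hb := le_abs_dotProduct_of_dist_le hu hv.le hlt
          have hb2 : 15 * (d : ℝ) ≤ t * |q g v| := by
            calc 15 * (d : ℝ) = t * (15 / 64 * (64 / √d)) := by
                  rw [ht]; field_simp
              _ ≤ t * |q g v| := by
                  refine mul_le_mul_of_nonneg_left (le_trans ?_ hb) ht0
                  have : 64 / √(d : ℝ) ≤ C / √d := by gcongr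
                  linarith
          rcases abs_cases (q g v) with ⟨h1, _⟩ | ⟨h1, _⟩
          · refine le_trans (ENNReal.ofReal_le_ofReal (Real.exp_le_exp.2 ?_)) le_self_add
            rwa [h1] at hb2
          · refine le_trans (ENNReal.ofReal_le_ofReal (Real.exp_le_exp.2 ?_)) le_add_self
            rw [h1] at hb2; linarith
      _ ≤ ∫⁻ v in S, G g v := lintegral_mono_set hsub
  have hup : ∫⁻ g, ∫⁻ v in S, G g v ∂volume ∂(entryLaw d) ≤
      ENNReal.ofReal (2 * Real.exp (4 * d)) * (ENNReal.ofReal ((9 / 8) ^ d) * V) := by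
    rw [lintegral_lintegral_swap hGm.aemeasurable]
    calc ∫⁻ v in S, ∫⁻ g, G g v ∂(entryLaw d) ≤
        ∫⁻ _ in S, ENNReal.ofReal (2 * Real.exp (4 * d)) := by
          refine setLIntegral_mono' measurableSet_ball fun v hv => ?_
          have hqv : Measurable fun g => q g v := hqm.comp (f := fun g => (g, v)) (by fun_prop)
          have hm : Measurable fun g => ENNReal.ofReal (Real.exp (t * q g v)) :=
            ENNReal.measurable_ofReal.comp (Real.measurable_exp.comp (hqv.const_mul t))
          simp only [hG]
          rw [lintegral_add_left hm]
          have hvn : ‖v‖ ^ 4 ≤ (9 / 8) ^ 4 := by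
            rw [hS, Metric.mem_ball, dist_zero_right] at hv
            gcongr
          have hexp : 2 * t ^ 2 * ‖v‖ ^ 4 / d ^ 2 ≤ 4 * (d : ℝ) := by
            rw [ht2, div_le_iff₀ (by positivity)]
            have := mul_le_mul_of_nonneg_left hvn (show 0 ≤ 2 * (d : ℝ) ^ 3 by positivity)
            have : 0 ≤ (d : ℝ) ^ 3 := by positivity
            nlinarith
          have h1 := lintegral_entryLaw_exp_dotProduct_le t v
          have h2 := lintegral_entryLaw_exp_dotProduct_le (-t) v
          rw [neg_sq] at h2
          have h3 := ENNReal.ofReal_le_ofReal (Real.exp_le_exp.2 hexp)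
          rw [two_mul, ENNReal.ofReal_add (Real.exp_pos _).le (Real.exp_pos _).le]
          exact add_le_add (h1.trans h3) (h2.trans h3)
      _ = _ := by rw [setLIntegral_const, hS, hvol _ (by norm_num)]
  have hmarkov := mul_meas_ge_le_lintegral₀ (μ := entryLaw d)
    (f := fun g => ∫⁻ v in S, G g v) hGm.lintegral_prod_right.aemeasurable
    (ENNReal.ofReal (Real.exp (15 * d)) * (ENNReal.ofReal ((1 / 8) ^ d) * V))
  have hP := (mul_le_mul_right (measure_mono hlow) _).trans (hmarkov.trans hup)
  set p := entryLaw d {g | C / √(d : ℝ) < matSpectralNorm (symMatrix g)}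
  have hP2 : (ENNReal.ofReal (Real.exp (15 * d)) * ENNReal.ofReal ((1 / 8) ^ d)) * p ≤
      ENNReal.ofReal (2 * Real.exp (4 * d)) * ENNReal.ofReal ((9 / 8) ^ d) := by
    refine (ENNReal.mul_le_mul_iff_left hV0 hVt).1 ?_
    calc _ = ENNReal.ofReal (Real.exp (15 * d)) * (ENNReal.ofReal ((1 / 8) ^ d) * V) * p := by ring
      _ ≤ _ := hP
      _ = _ := by ring
  rw [← ENNReal.ofReal_mul (by positivity), ← ENNReal.ofReal_mul (by positivity), mul_comm,
    ← ENNReal.le_div_iff_mul_le (by left; positivity) (by left; exact ENNReal.ofReal_ne_top),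
    ← ENNReal.ofReal_div_of_pos (by positivity)] at hP2
  refine hP2.trans (ENNReal.ofReal_le_ofReal ?_)
  rw [div_le_iff₀ (by positivity)]
  -- The volume ratio costs $9^d\le e^{3d}$, so the final exponent is $4+3-15=-8$ per dimension.
  have h9 : (9 / 8 : ℝ) ^ d ≤ Real.exp (3 * d) * (1 / 8) ^ d := by
    have : (9 : ℝ) ≤ Real.exp 3 := by
      have h3 : Real.exp 3 = Real.exp 1 ^ 3 := by rw [← Real.exp_nat_mul]; norm_num
      have := Real.exp_one_gt_d9
      rw [h3]
      calc (9 : ℝ) ≤ 2.7 ^ 3 := by norm_num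
        _ ≤ Real.exp 1 ^ 3 := by gcongr; linarith
    rw [mul_comm (3 : ℝ), Real.exp_nat_mul, ← mul_pow]
    gcongr
    linarith
  calc 2 * Real.exp (4 * d) * (9 / 8) ^ d ≤
      2 * Real.exp (4 * d) * (Real.exp (3 * d) * (1 / 8) ^ d) := by gcongr
    _ = 2 * Real.exp (-(8 * d)) * (Real.exp (15 * d) * (1 / 8) ^ d) := by
        rw [show (15 : ℝ) * d = 8 * d + (4 * d + 3 * d) by ring, Real.exp_add, Real.exp_add,
          Real.exp_neg]
        field_simp

end RobustCov

/-! ### Tail bound for the Frobenius norm -/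

namespace RobustCov
open Matrix

variable {d : ℕ}

theorem sum_sq_symMatrix (g : UpperPairs d → ℝ) :
    ∑ i, ∑ j, symMatrix g i j ^ 2 = 2 * ∑ p : UpperPairs d, g p ^ 2 := by
  have h : ∀ p : UpperPairs d, symMatrix g p.1.1 p.1.2 = g p := fun p => by
    simp [symMatrix, p.2]
  simp_rw [pow_two]
  rw [sum_symMatrix_mul g fun i j => symMatrix g i j, Finset.mul_sum]
  refine Finset.sum_congr rfl fun p _ => ?_
  rw [symMatrix_apply_comm g p.1.2 p.1.1, h]; ring

theorem card_upperPairs_le (d : ℕ) : (Fintype.card (UpperPairs d) : ℝ) ≤ d ^ 2 := by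
  have := Fintype.card_subtype_le fun p : Fin d × Fin d => p.1 < p.2
  rw [Fintype.card_prod, Fintype.card_fin] at this
  rw [pow_two]
  exact_mod_cast this

/-- Exponential Markov for $\frac d8\|A\|_F^2$, which is the form $\frac1{4d}|x|^2$ in at most $d^2$
standard Gaussians: its exponential moment is at most $e^{d/4+1/4}$, while $\|A\|_F>2$ forces the
value $e^{d/2}$. -/
theorem entryLaw_frobeniusNorm_gt_le (hd : d ≠ 0) {C : ℝ} (hC : 2 ≤ C) :
    entryLaw d {g | C < frobeniusNorm (symMatrix g)} ≤
      ENNReal.ofReal (Real.exp (1 / 4 - d / 4)) := by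
  have hdp : (0 : ℝ) < d := by positivity
  have hm : Measurable fun g : UpperPairs d → ℝ =>
      ENNReal.ofReal (Real.exp (d / 8 * (2 * ∑ p, g p ^ 2))) := by fun_prop
  have hn := card_upperPairs_le d
  set n : ℝ := (Fintype.card (UpperPairs d) : ℝ)
  set K : Matrix (UpperPairs d) (UpperPairs d) ℝ := (1 / (4 * d) : ℝ) • 1 with hK
  have hs : ∑ p, ∑ q, K p q ^ 2 = n * (1 / (4 * d)) ^ 2 := by
    simp [hK, Matrix.one_apply, ite_pow, n]
  have hs' : n * (1 / (4 * (d : ℝ))) ^ 2 ≤ 1 / 16 := by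
    rw [_root_.one_div_pow, mul_one_div, div_le_iff₀ (by positivity)]; nlinarith
  have htr : K.trace ≤ d / 4 := by
    rw [hK, trace_smul, trace_one, smul_eq_mul, one_div_mul_eq_div, div_le_iff₀ (by positivity)]
    change n ≤ _
    nlinarith
  have hmgf : ∫⁻ g, ENNReal.ofReal (Real.exp (d / 8 * (2 * ∑ p, g p ^ 2))) ∂(entryLaw d) ≤
      ENNReal.ofReal (Real.exp (d / 4 + 1 / 4)) := by
    rw [lintegral_entryLaw hm]
    have e : ∀ x : EuclideanSpace ℝ (UpperPairs d),
        (d : ℝ) / 8 * (2 * ∑ p, ((d : ℝ)⁻¹ * x p) ^ 2) = x.ofLp ⬝ᵥ K *ᵥ x.ofLp := by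
      intro x
      rw [hK, smul_mulVec, one_mulVec, dotProduct_smul, smul_eq_mul, dotProduct]
      simp only [mul_pow, ← Finset.mul_sum, pow_two (x.ofLp _)]
      field_simp
      ring
    simp_rw [e]
    refine (lintegral_exp_quadraticForm_le (by simp [hK, IsHermitian]) (hs.trans_le hs')).trans ?_
    refine ENNReal.ofReal_le_ofReal (Real.exp_le_exp.2 ?_)
    rw [hs]; linarith
  have hlow : ∀ g ∈ {g : UpperPairs d → ℝ | C < frobeniusNorm (symMatrix g)},
      ENNReal.ofReal (Real.exp (d / 2)) ≤
        ENNReal.ofReal (Real.exp (d / 8 * (2 * ∑ p, g p ^ 2))) := by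
    intro g hg
    have hg' : C < √(∑ i, ∑ j, symMatrix g i j ^ 2) := hg
    rw [Real.lt_sqrt (by linarith), sum_sq_symMatrix] at hg'
    refine ENNReal.ofReal_le_ofReal (Real.exp_le_exp.2 ?_)
    have : 4 ≤ 2 * ∑ p, g p ^ 2 := by nlinarith
    nlinarith
  have hP := (mul_le_mul_right (measure_mono hlow) _).trans
    ((mul_meas_ge_le_lintegral₀ hm.aemeasurable _).trans hmgf)
  rw [mul_comm, ← ENNReal.le_div_iff_mul_le (by left; positivity)
    (by left; exact ENNReal.ofReal_ne_top), ← ENNReal.ofReal_div_of_pos (by positivity),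
    ← Real.exp_sub] at hP
  refine hP.trans (ENNReal.ofReal_le_ofReal (Real.exp_le_exp.2 ?_))
  linarith

theorem tendsto_entryLaw_normEvent {C₁ C₂ : ℝ} (h₁ : 64 ≤ C₁) (h₂ : 64 ≤ C₂) :
    Tendsto (fun d : ℕ => entryLaw d (normEvent d C₁ C₂)) atTop (𝓝 1) := by
  have hlim : Tendsto (fun d : ℕ => 1 - (ENNReal.ofReal (2 * Real.exp (-(8 * d))) +
      ENNReal.ofReal (Real.exp (1 / 4 - d / 4)))) atTop (𝓝 1) := by
    have hd : Tendsto (fun d : ℕ => (d : ℝ)) atTop atTop := tendsto_natCast_atTop_atTop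
    have a1 : Tendsto (fun d : ℕ => 2 * Real.exp (-(8 * d))) atTop (𝓝 0) := by
      have := (Real.tendsto_exp_neg_atTop_nhds_zero.comp
        (hd.const_mul_atTop (by norm_num : (0 : ℝ) < 8))).const_mul 2
      simpa using this
    have a2 : Tendsto (fun d : ℕ => Real.exp (1 / 4 - d / 4)) atTop (𝓝 0) :=
      Real.tendsto_exp_atBot.comp
        (tendsto_const_nhds.add_atBot (tendsto_neg_atTop_atBot.comp
          (hd.atTop_div_const (by norm_num : (0 : ℝ) < 4))))
    have a3 := (ENNReal.tendsto_ofReal a1).add (ENNReal.tendsto_ofReal a2)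
    have := ENNReal.Tendsto.sub (tendsto_const_nhds (x := (1 : ℝ≥0∞))) a3 (by simp)
    simpa using this
  refine tendsto_of_tendsto_of_tendsto_of_le_of_le' hlim tendsto_const_nhds ?_
    (Eventually.of_forall fun d => prob_le_one)
  filter_upwards [eventually_ne_atTop 0] with d hd
  rw [tsub_le_iff_right, ← prob_add_prob_compl (μ := entryLaw d)
    (measurableSet_normEvent (d := d) C₁ C₂)]
  gcongr
  have hsub : (normEvent d C₁ C₂)ᶜ ⊆ {g | C₁ / √(d : ℝ) < matSpectralNorm (symMatrix g)} ∪
      {g | C₂ < frobeniusNorm (symMatrix g)} := by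
    intro g hg
    simp only [normEvent, Set.mem_compl_iff, Set.mem_ofPred_eq, not_and_or, not_le] at hg
    exact hg
  exact (measure_mono hsub).trans ((measure_union_le _ _).trans (add_le_add
    (entryLaw_spectralNorm_gt_le hd h₁) (entryLaw_frobeniusNorm_gt_le hd (by linarith))))

/-! ### The limit of the chi-squared -/

theorem lintegral_cond_le {Ω : Type*} [MeasurableSpace Ω] (μ : Measure Ω) (s : Set Ω)
    (f : Ω → ℝ≥0∞) : ∫⁻ ω, f ω ∂μ[|s] ≤ (μ s)⁻¹ * ∫⁻ ω, f ω ∂μ := by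
  rw [ProbabilityTheory.cond, lintegral_smul_measure, smul_eq_mul]
  gcongr
  exact Measure.restrict_le_self

theorem tendsto_chiSq_ensembleSamples {C₁ C₂ : ℝ}
    (hlim : Tendsto (fun d : ℕ => entryLaw d (normEvent d C₁ C₂)) atTop (𝓝 1)) {N : ℕ → ℕ}
    (hN : (fun d : ℕ => (N d : ℝ)) =o[atTop] (fun d : ℕ => (d : ℝ) ^ 2)) :
    Tendsto (fun d : ℕ => chiSq (iidSamples (N d) (stdG d)) (ensembleSamples d C₁ C₂ (N d))
      (ensembleSamples d C₁ C₂ (N d))) atTop (𝓝 1) := by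
  obtain ⟨L, hL, hchi⟩ := exists_noisyChiSq_le C₁
  set ε : ℕ → ℝ := fun d => N d / (d : ℝ) ^ 2 with hε
  have hε0 : Tendsto ε atTop (𝓝 0) := hN.tendsto_div_nhds_zero
  set R : ℝ := (48 * L ^ 2 + 9842) * (C₂ ^ 2) ^ 2 with hR
  set T : ℝ := (4 * L + 81 / 2) * C₂ ^ 2 with hT
  have hsmall : Tendsto (fun d => ε d ^ 2 * R) atTop (𝓝 0) := by
    simpa using (hε0.pow 2).mul_const R
  have hup : Tendsto (fun d : ℕ => (entryLaw d (normEvent d C₁ C₂))⁻¹ *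
      ENNReal.ofReal (Real.exp (ε d * L + (ε d * T + 4 * (ε d ^ 2 * R))))) atTop (𝓝 1) := by
    have h1 : Tendsto (fun d => ε d * L + (ε d * T + 4 * (ε d ^ 2 * R))) atTop (𝓝 0) := by
      simpa using (hε0.mul_const L).add ((hε0.mul_const T).add (hsmall.const_mul 4))
    have h2 := ENNReal.tendsto_ofReal ((Real.continuous_exp.tendsto 0).comp h1)
    have h3 := tendsto_inv_iff.2 hlim
    have := ENNReal.Tendsto.mul h3 (by simp) h2 (by simp)
    simpa using this
  have hC : Tendsto (fun d : ℕ => C₁ / √(d : ℝ)) atTop (𝓝 0) :=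
    tendsto_const_nhds.div_atTop (Real.tendsto_sqrt_atTop.comp tendsto_natCast_atTop_atTop)
  have hgood : ∀ᶠ d : ℕ in atTop, C₁ / √(d : ℝ) < 1 / 9 ∧
      entryLaw d (normEvent d C₁ C₂) ≠ 0 ∧ d ≠ 0 ∧ ε d ^ 2 * R ≤ 1 / 16 :=
    (hC.eventually_lt_const (by norm_num)).and ((hlim.eventually_ne one_ne_zero).and
      ((eventually_ne_atTop 0).and (hsmall.eventually_le_const (by norm_num))))
  refine tendsto_of_tendsto_of_tendsto_of_le_of_le' tendsto_const_nhds hup ?_ ?_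
  · filter_upwards [hgood] with d ⟨h1, h2, _⟩ using (chiSq_ensembleSamples h1 h2 (N d)).2
  filter_upwards [hgood, hchi] with d ⟨h1, h2, hd, h3⟩ hbound
  rw [(chiSq_ensembleSamples h1 h2 (N d)).1]
  have hdp : (0 : ℝ) < d := by positivity
  have hε0' : 0 ≤ ε d := by positivity
  have hNε : (N d : ℝ) = ε d * d ^ 2 := by simp only [hε]; field_simp
  have hprob : IsProbabilityMeasure ((entryLaw d)[|normEvent d C₁ C₂]) :=
    cond_isProbabilityMeasure h2
  have hmem := ae_cond_mem (μ := entryLaw d) (measurableSet_normEvent (d := d) C₁ C₂)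
  refine le_trans (lintegral_mono_ae (g := fun _ => (entryLaw d (normEvent d C₁ C₂))⁻¹ *
    ENNReal.ofReal (Real.exp (ε d * L + (ε d * T + 4 * (ε d ^ 2 * R))))) ?_) (by simp)
  -- The outer matrix is now fixed; its Frobenius bound controls the quadratic form in the inner
  -- one.
  filter_upwards [hmem] with h hh
  have hF : ∑ i, ∑ j, symMatrix h i j ^ 2 ≤ C₂ ^ 2 := (Real.sqrt_le_iff.1 hh.2).2
  have hmgf := lintegral_entryLaw_exp_traceForm_le hL hε0' hd h hF h3
  calc ∫⁻ g, ENNReal.ofReal (noisyChiSq (symMatrix h) (symMatrix g)) ^ N d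
        ∂(entryLaw d)[|normEvent d C₁ C₂]
      ≤ ∫⁻ g, ENNReal.ofReal (Real.exp (ε d * L)) * ENNReal.ofReal (Real.exp (ε d * d ^ 2 *
          (L * (symMatrix g * symMatrix h).trace ^ 2 +
            81 / 4 * (symMatrix g * symMatrix h * (symMatrix g * symMatrix h)).trace)))
          ∂(entryLaw d)[|normEvent d C₁ C₂] := by
        refine lintegral_mono_ae ?_
        filter_upwards [hmem] with g hg
        rw [← ENNReal.ofReal_pow (noisyChiSq_nonneg _ _), ← ENNReal.ofReal_mul (Real.exp_pos _).le,
          ← Real.exp_add]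
        refine ENNReal.ofReal_le_ofReal ?_
        refine (pow_le_pow_left₀ (noisyChiSq_nonneg _ _) (hbound _ _ hh.1 hg.1) _).trans_eq ?_
        have e1 : (symMatrix h * symMatrix g).trace = (symMatrix g * symMatrix h).trace :=
          trace_mul_comm _ _
        have e2 : (symMatrix h * symMatrix g * (symMatrix h * symMatrix g)).trace =
            (symMatrix g * symMatrix h * (symMatrix g * symMatrix h)).trace := by
          rw [Matrix.mul_assoc, trace_mul_comm]
          simp only [Matrix.mul_assoc]
        rw [← Real.exp_nat_mul, e1, e2, hNε]
        congr 1
        field_simp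
        ring
    _ = ENNReal.ofReal (Real.exp (ε d * L)) * ∫⁻ g, ENNReal.ofReal (Real.exp (ε d * d ^ 2 *
          (L * (symMatrix g * symMatrix h).trace ^ 2 +
            81 / 4 * (symMatrix g * symMatrix h * (symMatrix g * symMatrix h)).trace)))
          ∂(entryLaw d)[|normEvent d C₁ C₂] := lintegral_const_mul' _ _ ENNReal.ofReal_ne_top
    -- The spectral bound on the inner matrix has been used for the pointwise estimate, so its
    -- conditioning can be dropped and the integral becomes Gaussian.
    _ ≤ ENNReal.ofReal (Real.exp (ε d * L)) * ((entryLaw d (normEvent d C₁ C₂))⁻¹ *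
          ENNReal.ofReal (Real.exp (ε d * T + 4 * (ε d ^ 2 * R)))) := by
        gcongr
        exact (lintegral_cond_le _ _ _).trans (by gcongr)
    _ = _ := by
        rw [Real.exp_add (ε d * L), ENNReal.ofReal_mul (Real.exp_pos _).le]; ring

end RobustCov

theorem mainTheorem2 :
    (∃ C₀ : ℝ, ∀ C₁ C₂ : ℝ, C₀ ≤ C₁ → C₀ ≤ C₂ →
      Tendsto (fun d : ℕ => RobustCov.entryLaw d (RobustCov.normEvent d C₁ C₂)) atTop (𝓝 1)) ∧
    (∀ C₁ C₂ : ℝ,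
      Tendsto (fun d : ℕ => RobustCov.entryLaw d (RobustCov.normEvent d C₁ C₂)) atTop (𝓝 1) →
      ∀ N : ℕ → ℕ, (fun d : ℕ => (N d : ℝ)) =o[atTop] (fun d : ℕ => (d : ℝ) ^ 2) →
        Tendsto (fun d : ℕ =>
          RobustCov.chiSq (RobustCov.iidSamples (N d) (RobustCov.stdG d))
            (RobustCov.ensembleSamples d C₁ C₂ (N d))
            (RobustCov.ensembleSamples d C₁ C₂ (N d))) atTop (𝓝 1)) :=
  ⟨⟨64, fun _ _ h₁ h₂ => RobustCov.tendsto_entryLaw_normEvent h₁ h₂⟩,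
    fun _ _ hlim _ hN => RobustCov.tendsto_chiSq_ensembleSamples hlim hN⟩
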